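/- \textbf{Setting.} Consider a two-sorted first-order structure $\mathcal K=(K,\mathcal F(K))$, where $K$ is a field and $\mathcal F(K)$ is a second sort with a membership relation ${\in^*}\subseteq K\times\mathcal F(K)$. ``Definable'' means first-order definable, with parameters, in $\mathcal K^{eq}$. For definable sets $X,Y$ and a definable relation ${\in^*}\subseteq X\times Y$, we call $Y=\mathcal F(X)$ a \emph{definable finite power set} of $X$ if: elements of $Y$ with the same extension are equal; $Y$ contains elements with extension $\emptyset$ and $\{a\}$ for every $a\in X$, and is closed under binary unions; and every definable $U\subseteq Y$ that contains $\emptyset$ and is closed under $B\mapsto B\cup\{x\}$ ($x\in X$) is all of $Y$. Such a $Y$ is unique up to a definable bijection preserving extensions. The subsets of $X$ that are extensions of elements of $\mathcal F(X)$ are called \emph{hyperfinite}; we identify elements of $\mathcal F(X)$ with their extensions. Assume that $\mathcal F(K)$ is a definable finite power set of $K$. Let $\mathbf N\subseteq K$ be the set of all $x\in K$ for which there is a hyperfinite $A\subseteq K$ with $0,x\in A$ such that for all $z\in A$: $z\neq0\Rightarrow z-1\in A$, and $z\ne x\Rightarrow z+1\in A$. Assume that $\mathcal K$ has \emph{definable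 characteristic zero}, i.e. $-1\notin\mathbf N$. (Then $\mathbf N$ is a model of Peano Arithmetic, possibly non-standard, and every definable set in $\mathcal K^{eq}$ has a definable finite power set.) For $n\in\mathbf N$ put $(n)=\{i\in\mathbf N: i<n\}$. For a definable set $X$, let $X^{(n)}$ be the set of functions $(n)\to X$ with hyperfinite graph (hyperfinite sequences of length $n$). Let $R$ be a definable subfield of $K$ and let $n\in\mathbf N$ (possibly non-standard). The ring $R[x_i]^{\mathrm{def}}_{i<n}$ of (possibly non-standard) polynomials consists of all partial functions $p$ from $\mathbf N^{(n)}$ to $R\setminus\{0\}$ with hyperfinite graph. Here $I\in\mathbf N^{(n)}$ stands for the monomial $x^I$, and $p$ gives the coefficients of the monomials in its domain, the other coefficients being $0$. Addition is coefficientwise, and $pq$ is defined by definable recursion on hyperfinite sets of monomials: $p_{|\emptyset}\,q=0$ and $p_{|B\cup\{I\}}\,q=p_{|B}\,q+p_Ix^Iq$ for $I\notin B$, where $x^Ix^J=x^{I+J}$. The sum $\sum_{i<m}p_i$ of a hyperfinite sequence of polynomials ($m\in\mathbf N$) is defined by definable recursion on $\mathbf N$. \textbf{Theorem (Hilbert's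 basis theorem).} Let $\mathcal K=(K,\mathcal F(K))$ be a field of definable characteristic zero, $R\subseteq K$ a definable subfield, and $n\in\mathbf N$. Then every definable ideal $\mathcal I$ of $R[x_i]^{\mathrm{def}}_{i<n}$ is hyperfinitely generated: there is a hyperfinite set $J\subseteq\mathcal I$ such that every $p\in\mathcal I$ is of the form $p=\sum_{i<m}a_ig_i$ with $m\in\mathbf N$, $(g_i)_{i<m}\in J^{(m)}$ and $(a_i)_{i<m}\in(R[x_i]^{\mathrm{def}}_{i<n})^{(m)}$. -/

import Mathlib

namespace HyperPoly

universe u v w w'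

/-! ### The two-sorted structure `(K, F)` and definability in it -/

/-- Relation symbols: "is in the sort `K`", graphs of `+` and `·` on `K`, membership. -/
inductive Sym : ℕ → Type
  | elt : Sym 1
  | add : Sym 3
  | mul : Sym 3
  | mem : Sym 2

/-- The language of fields with a second sort of (codes of) sets. The two sorts are merged into
one universe `K ⊕ F` with a predicate for the first sort. -/
def lang : FirstOrder.Language.{0, 0} := ⟨fun _ => Empty, Sym⟩

/-- The universe of the structure `(K, F, ε)`. -/
def Carrier {K : Type u} {F : Type v} (_ε : K → F → Prop) : Type (max u v) := K ⊕ F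

instance instStructureCarrier {K : Type u} {F : Type v} [Field K] (ε : K → F → Prop) :
    lang.Structure (Carrier ε) where
  funMap f := nomatch f
  RelMap r v := match r with
    | .elt => ∃ x : K, v 0 = Sum.inl x
    | .add => ∃ x y : K, v 0 = Sum.inl x ∧ v 1 = Sum.inl y ∧ v 2 = Sum.inl (x + y)
    | .mul => ∃ x y : K, v 0 = Sum.inl x ∧ v 1 = Sum.inl y ∧ v 2 = Sum.inl (x * y)
    | .mem => ∃ (x : K) (A : F), v 0 = Sum.inl x ∧ v 1 = Sum.inr A ∧ ε x A

section

variable {K : Type u} {F : Type v} [Field K] {ε : K → F → Prop}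

/-- First-order definability with arbitrary parameters in `(K, F, ε)`. -/
def Dfn {α : Type} (s : Set (α → Carrier ε)) : Prop :=
  (Set.univ : Set (Carrier ε)).Definable lang s

theorem dfn_elt {α : Type} (i : α) :
    Dfn {v : α → Carrier ε | ∃ x : K, v i = Sum.inl x} := by
  refine Set.Definable.mono (A := ∅) ?_ (Set.empty_subset _)
  rw [Set.empty_definable_iff]
  refine ⟨FirstOrder.Language.Relations.formula (L := lang) (n := 1) Sym.elt
    (fun _ => FirstOrder.Language.Term.var i), ?_⟩
  ext v
  simp only [Set.mem_ofPred_eq]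
  exact Iff.rfl

theorem dfn_eq {α : Type} (i j : α) : Dfn {v : α → Carrier ε | v i = v j} := by
  refine Set.Definable.mono (A := ∅) ?_ (Set.empty_subset _)
  rw [Set.empty_definable_iff]
  refine ⟨FirstOrder.Language.Term.equal (FirstOrder.Language.Term.var i)
    (FirstOrder.Language.Term.var j), ?_⟩
  ext v
  simp [FirstOrder.Language.Formula.realize_equal]

end

/-! ### Definable sets of the structure with imaginaries -/

/-- A presentation of the set `X` as a definable set of `(K, F, ε)^eq`: `X` is identified with the
quotient of a definable set of finite tuples by a definable equivalence relation. Here `rep v x`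
says that the tuple `v` represents `x`; the set of pairs of tuples that represent the same
element is definable (hence so is the set of tuples that represent some element). -/
structure Chart {K : Type u} {F : Type v} [Field K] (ε : K → F → Prop) (X : Type w) where
  ι : Type
  finite : Finite ι
  rep : (ι → Carrier ε) → X → Prop
  rep_unique : ∀ v x y, rep v x → rep v y → x = y
  rep_surj : ∀ x, ∃ v, rep v x
  ker_dfn : Dfn {v : ι ⊕ ι → Carrier ε | ∃ x, rep (v ∘ Sum.inl) x ∧ rep (v ∘ Sum.inr) x}

section

variable {K : Type u} {F : Type v} [Field K] {ε : K → F → Prop}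

/-- A subset of a presented set is definable if the set of tuples representing its elements is. -/
def Chart.DefinableSet {X : Type w} (c : Chart ε X) (S : Set X) : Prop :=
  Dfn {v : c.ι → Carrier ε | ∃ x ∈ S, c.rep v x}

/-- The first sort `K`. -/
def chartK (ε : K → F → Prop) : Chart ε K where
  ι := Unit
  finite := inferInstance
  rep v x := v () = Sum.inl x
  rep_unique v x y hx hy := Sum.inl_injective (hx.symm.trans hy)
  rep_surj x := ⟨fun _ => Sum.inl x, rfl⟩
  ker_dfn := by
    have h := (dfn_elt (ε := ε) (Sum.inl () : Unit ⊕ Unit)).inter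
      (dfn_eq (ε := ε) (Sum.inl () : Unit ⊕ Unit) (Sum.inr ()))
    refine (congrArg Dfn ?_).mpr h
    ext v
    constructor
    · rintro ⟨x, h1, h2⟩
      exact ⟨⟨x, h1⟩, h1.trans h2.symm⟩
    · rintro ⟨⟨x, h1⟩, h2⟩
      exact ⟨x, h1, (Eq.symm h2).trans h1⟩

/-- The second sort `F`. -/
def chartF (ε : K → F → Prop) : Chart ε F where
  ι := Unit
  finite := inferInstance
  rep v A := v () = Sum.inr A
  rep_unique v x y hx hy := Sum.inr_injective (hx.symm.trans hy)
  rep_surj x := ⟨fun _ => Sum.inr x, rfl⟩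
  ker_dfn := by
    have h := (dfn_elt (ε := ε) (Sum.inl () : Unit ⊕ Unit)).compl.inter
      (dfn_eq (ε := ε) (Sum.inl () : Unit ⊕ Unit) (Sum.inr ()))
    refine (congrArg Dfn ?_).mpr h
    ext v
    constructor
    · rintro ⟨x, h1, h2⟩
      refine ⟨?_, h1.trans h2.symm⟩
      rintro ⟨y, hy⟩
      exact Sum.inl_ne_inr (hy.symm.trans h1)
    · rintro ⟨h1, h2⟩
      rcases h3 : v (Sum.inl ()) with y | A
      · exact absurd ⟨y, h3⟩ h1
      · exact ⟨A, h3, (Eq.symm h2).trans h3⟩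

/-- The product of two presented sets. -/
def Chart.prod {X : Type w} {Y : Type w'} (c : Chart ε X) (d : Chart ε Y) : Chart ε (X × Y) where
  ι := c.ι ⊕ d.ι
  finite := by
    have := c.finite
    have := d.finite
    infer_instance
  rep v p := c.rep (v ∘ Sum.inl) p.1 ∧ d.rep (v ∘ Sum.inr) p.2
  rep_unique v x y hx hy :=
    Prod.ext (c.rep_unique _ _ _ hx.1 hy.1) (d.rep_unique _ _ _ hx.2 hy.2)
  rep_surj x := by
    obtain ⟨a, ha⟩ := c.rep_surj x.1
    obtain ⟨b, hb⟩ := d.rep_surj x.2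
    exact ⟨Sum.elim a b, ha, hb⟩
  ker_dfn := by
    have h := (c.ker_dfn.preimage_comp
      (Sum.map Sum.inl Sum.inl : c.ι ⊕ c.ι → (c.ι ⊕ d.ι) ⊕ (c.ι ⊕ d.ι))).inter
      (d.ker_dfn.preimage_comp
      (Sum.map Sum.inr Sum.inr : d.ι ⊕ d.ι → (c.ι ⊕ d.ι) ⊕ (c.ι ⊕ d.ι)))
    refine (congrArg Dfn ?_).mpr h
    ext v
    constructor
    · rintro ⟨x, h1, h2⟩
      exact ⟨⟨x.1, h1.1, h2.1⟩, ⟨x.2, h1.2, h2.2⟩⟩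
    · rintro ⟨⟨x, h1, h2⟩, ⟨y, h3, h4⟩⟩
      exact ⟨(x, y), ⟨h1, h3⟩, ⟨h2, h4⟩⟩

/-- The empty set. -/
def Chart.empty (X : Type w) [IsEmpty X] : Chart ε X where
  ι := Empty
  finite := inferInstance
  rep _ _ := False
  rep_unique _ _ _ h _ := h.elim
  rep_surj x := isEmptyElim x
  ker_dfn := by
    refine (congrArg Dfn ?_).mpr (Set.definable_empty)
    ext v
    simp

/-! ### Definable finite power sets and hyperfinite sets -/

/-- `Y` is a definable finite power set of `X` with respect to the membership relation `E`. -/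
structure IsDefFinPow {X : Type w} {Y : Type w'} (c : Chart ε X) (d : Chart ε Y)
    (E : X → Y → Prop) : Prop where
  mem_definable : (c.prod d).DefinableSet {p | E p.1 p.2}
  extensionality : ∀ B C : Y, (∀ x, E x B ↔ E x C) → B = C
  empty : ∃ O : Y, ∀ x, ¬ E x O
  singleton : ∀ a : X, ∃ S : Y, ∀ x, E x S ↔ x = a
  union : ∀ B C : Y, ∃ D : Y, ∀ x, E x D ↔ E x B ∨ E x C
  induction : ∀ U : Set Y, d.DefinableSet U →
    (∀ O : Y, (∀ x, ¬ E x O) → O ∈ U) →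
    (∀ (a : X) (B C : Y), B ∈ U → (∀ x, E x C ↔ E x B ∨ x = a) → C ∈ U) →
    U = Set.univ

/-- A family of subsets of `X` which is itself presented as a definable set. -/
structure Family {K : Type u} {F : Type v} [Field K] (ε : K → F → Prop) (X : Type w) where
  sets : Set (Set X)
  chart : Chart ε sets

open Classical in
/-- The definable finite power set of `X` (unique up to a definable bijection that preserves
extensions), its elements being identified with their extensions. If `X` had none, this would be
the empty family. -/
noncomputable def finPow {X : Type w} (c : Chart ε X) : Family ε X :=
  if h : ∃ D : Family ε X, IsDefFinPow c D.chart (fun x A => x ∈ A.1) then h.choose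
  else ⟨∅, Chart.empty _⟩

/-- The type of hyperfinite subsets of `X`. -/
abbrev Hyp {X : Type w} (c : Chart ε X) : Type w := (finPow c).sets

/-- The set of hyperfinite subsets of `X` as a definable set. -/
noncomputable abbrev chartHyp {X : Type w} (c : Chart ε X) : Chart ε (Hyp c) := (finPow c).chart

/-! ### The internal natural numbers -/

/-- The internal natural numbers: those `x` for which there is a hyperfinite set containing `0`
and `x`, closed under predecessors of nonzero elements and successors of elements `≠ x`. -/
def N (ε : K → F → Prop) : Set K :=
  {x | ∃ A : F, ε 0 A ∧ ε x A ∧ ∀ z, ε z A → (z ≠ 0 → ε (z - 1) A) ∧ (z ≠ x → ε (z + 1) A)}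

/-- `(K, F, ε)` is a field of definable characteristic zero. -/
structure DefCharZero (ε : K → F → Prop) : Prop where
  isDefFinPow : IsDefFinPow (chartK ε) (chartF ε) ε
  neg_one_notMem : (-1 : K) ∉ N ε

/-- The initial segment `(n)` of all `i ∈ N` with `i < n`. -/
def Seg (ε : K → F → Prop) (n : K) : Set K := {i | i ∈ N ε ∧ i ≠ n ∧ n - i ∈ N ε}

/-- `f` is (the graph of) a hyperfinite sequence of length `n` of elements of `S`. -/
def IsSeq {X : Type w} {c : Chart ε X} (n : K) (S : Set X) (f : Hyp ((chartK ε).prod c)) : Prop :=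
  (∀ q ∈ f.1, q.1 ∈ Seg ε n ∧ q.2 ∈ S) ∧ ∀ i ∈ Seg ε n, ∃! x, (i, x) ∈ f.1

/-! ### Monomials -/

/-- Hyperfinite subsets of `K × K`; this contains all the sets `N^(n)` of exponents. -/
abbrev Rel₂ (ε : K → F → Prop) : Type u := Hyp ((chartK ε).prod (chartK ε))

noncomputable abbrev chartRel₂ (ε : K → F → Prop) : Chart ε (Rel₂ ε) :=
  chartHyp ((chartK ε).prod (chartK ε))

/-- The set `N^(n)` of hyperfinite sequences of length `n` in `N`, that is, of (exponents of)
monomials in `n` variables. -/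
def Mon (ε : K → F → Prop) (n : K) : Set (Rel₂ ε) := {I | IsSeq n (N ε) I}

/-- For `I`, `J`, `L` in `N^(n)`: `L = I + J`, that is, `x^L = x^I * x^J`. -/
def IsMonMul (I J L : Rel₂ ε) : Prop :=
  ∀ i a b, (i, a) ∈ I.1 → (i, b) ∈ J.1 → (i, a + b) ∈ L.1

/-! ### Non-standard polynomials -/

/-- Hyperfinite subsets of `Rel₂ × K`; this contains all polynomials. -/
abbrev Pre (ε : K → F → Prop) : Type u := Hyp ((chartRel₂ ε).prod (chartK ε))

noncomputable abbrev chartPre (ε : K → F → Prop) : Chart ε (Pre ε) :=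
  chartHyp ((chartRel₂ ε).prod (chartK ε))

/-- The set `R[x_i]_{i<n}^def`: the hyperfinite partial functions from `N^(n)` to `R \ {0}`. -/
def Poly (ε : K → F → Prop) (R : Subfield K) (n : K) : Set (Pre ε) :=
  {p | (∀ q ∈ p.1, q.1 ∈ Mon ε n ∧ q.2 ∈ R ∧ q.2 ≠ 0) ∧
    ∀ I a b, (I, a) ∈ p.1 → (I, b) ∈ p.1 → a = b}

open Classical in
/-- The coefficient of the monomial `x^I` in `p`. -/
noncomputable def coeff (p : Pre ε) (I : Rel₂ ε) : K :=
  if h : ∃ a, (I, a) ∈ p.1 then h.choose else 0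

/-- The support of `p`. -/
def supp (p : Pre ε) : Set (Rel₂ ε) := {I | ∃ a, (I, a) ∈ p.1}

/-- `p` is the zero polynomial. -/
def IsZero (p : Pre ε) : Prop := p.1 = ∅

/-- `r = p + q`. -/
def IsAdd (p q r : Pre ε) : Prop := ∀ I, coeff r I = coeff p I + coeff q I

/-- `r = a x^I q`, for polynomials in `n` variables. -/
def IsTermMul (n : K) (a : K) (I : Rel₂ ε) (q r : Pre ε) : Prop :=
  (∀ J ∈ Mon ε n, ∀ L ∈ Mon ε n, IsMonMul I J L → coeff r L = a * coeff q J) ∧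
  ∀ L ∈ Mon ε n, (∀ J ∈ Mon ε n, ¬ IsMonMul I J L) → coeff r L = 0

/-- `r = p q` in `R[x_i]_{i<n}^def`. The product is defined by definable recursion on hyperfinite
sets `A` of monomials: `G A` is the product of `q` with the restriction of `p` to `A`. -/
def IsMul (R : Subfield K) (n : K) (p q r : Pre ε) : Prop :=
  ∃ G : Hyp (chartRel₂ ε) → Pre ε,
    ((chartHyp (chartRel₂ ε)).prod (chartPre ε)).DefinableSet
      {s | s.1.1 ⊆ Mon ε n ∧ G s.1 = s.2} ∧
    (∀ A, A.1 ⊆ Mon ε n → G A ∈ Poly ε R n) ∧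
    (∀ A, A.1 = ∅ → IsZero (G A)) ∧
    (∀ A B, ∀ I ∈ Mon ε n, B.1 ⊆ Mon ε n → I ∉ B.1 → A.1 = insert I B.1 →
      ∃ t ∈ Poly ε R n, IsTermMul n (coeff p I) I q t ∧ IsAdd (G B) t (G A)) ∧
    ∃ A, A.1 = supp p ∧ G A = r

/-- `s` is the hyperfinite sum of the sequence `(t_i)_{i<m}` in `R[x_i]_{i<n}^def`, defined by
definable recursion on `N`: `f i` is the sum of the first `i` terms. -/
def IsSum (R : Subfield K) (n m : K) (t : Hyp ((chartK ε).prod (chartPre ε))) (s : Pre ε) : Prop :=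
  ∃ f : K → Pre ε,
    ((chartK ε).prod (chartPre ε)).DefinableSet {q | q.1 ∈ N ε ∧ f q.1 = q.2} ∧
    (∀ i ∈ N ε, f i ∈ Poly ε R n) ∧
    IsZero (f 0) ∧
    (∀ i ∈ Seg ε m, ∀ q, (i, q) ∈ t.1 → IsAdd (f i) q (f (i + 1))) ∧
    f m = s

/-! ### Definable ideals -/

/-- `I` is an ideal of the ring `R[x_i]_{i<n}^def`. -/
structure IsPolyIdeal (R : Subfield K) (n : K) (I : Set (Pre ε)) : Prop where
  subset : I ⊆ Poly ε R n
  zero_mem : ∃ z ∈ I, IsZero z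
  add_mem : ∀ p ∈ I, ∀ q ∈ I, ∀ r ∈ Poly ε R n, IsAdd p q r → r ∈ I
  mul_mem : ∀ p ∈ Poly ε R n, ∀ q ∈ I, ∀ r ∈ Poly ε R n, IsMul R n p q r → r ∈ I

/-- `J` generates `I`: `J ⊆ I`, and every element of `I` is a hyperfinite sum
`∑_{i<m} a_i g_i` with `(g_i)_{i<m}` a hyperfinite sequence in `J` and `(a_i)_{i<m}` one of
polynomials (`t` is the hyperfinite sequence of the products `a_i g_i`). -/
def Generates (R : Subfield K) (n : K) (J I : Set (Pre ε)) : Prop :=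
  J ⊆ I ∧ ∀ p ∈ I, ∃ m ∈ N ε, ∃ g a t : Hyp ((chartK ε).prod (chartPre ε)),
    IsSeq m J g ∧ IsSeq m (Poly ε R n) a ∧ IsSeq m (Poly ε R n) t ∧
    (∀ i x y z, (i, x) ∈ a.1 → (i, y) ∈ g.1 → (i, z) ∈ t.1 → IsMul R n x y z) ∧
    IsSum R n m t p

end

end HyperPoly

/-!
Hilbert's basis theorem holds for `R[x_i]_{i<n}^def` because the Gröbner basis argument can be
carried out with definable induction, even though `n` may be non-standard. Induction on the number
of variables over all definable ideals is not available, since that statement is not first-order.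
Instead everything is derived from two facts about exponents in a fixed `N^(n)`.

* Dickson's lemma (`dickson`): a definable set of elements with exponents in `N^(n)` has a
  hyperfinite subset whose exponents lie below all others in the product order. The first-order
  statement that is proved by (descending) induction on `k` concerns the elements of one fixed
  definable set that obey arbitrary bounds, possibly infinite, on their first `k` coordinates.
* Lexicographic well-foundedness (`exists_lex_minimal`): every nonempty definable set of such
  elements has one that is lexicographically minimal, by minimizing one coordinate after the other.

Dickson's lemma, applied to the leading exponents of the nonzero elements of the ideal, yields the
generating set `J`. If some element of the ideal were not a hyperfinite combination of `J`, choose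
one with lexicographically minimal leading monomial. Subtracting a term multiple of an element of
`J` cancels its leading term (`exists_reduction`), and the difference is a combination by
minimality. Only coefficients `a_i` that are single terms occur. Hence being a combination is a
first-order property (`Generated`), and the recursively defined product `IsMul` is needed only
when the left factor is a term (`TermStep.isMul`).

The argument rests on two layers of foundations.

* Definability. `DefMap` says that a map between presented sets has a definable graph. As `Prop` is
  itself presented, definable predicates are a special case, and `fun_prop` can prove definability
  of a formula from its syntactic form.
* Existence of definable finite power sets. A set with codes for hyperfinite sequences (`IsCoding`,
  an analogue of Gödel's `β`-function) has a definable finite power set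
  (`HasCoding.exists_isDefFinPow`). Codes exist for `K` (`DefCharZero.hasCoding_base`), and they
  are inherited by products and by definable finite power sets, so that all the sets in the
  definition of polynomials are covered.
-/

namespace HyperPoly

universe u v w w' w'' w₃

/-! ### A calculus of definable maps -/

/-- The canonical presentation of a set as a definable set of `(K, F, ε)^eq`. Making it a class lets
the presentations of products and of power sets be found by instance search. -/
class HasChart {K : Type u} {F : Type v} [Field K] (ε : K → F → Prop) (X : Type w) where
  chart : Chart ε X

/-- The canonical presentation of `X`. -/
abbrev ch {K : Type u} {F : Type v} [Field K] (ε : K → F → Prop) (X : Type w) [HasChart ε X] :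
    Chart ε X := HasChart.chart

section

variable {K : Type u} {F : Type v} [Field K] {ε : K → F → Prop}

/-- The set of tuples that represent some element is definable. -/
theorem Chart.dom_dfn {X : Type w} (c : Chart ε X) :
    Dfn {v : c.ι → Carrier ε | ∃ x, c.rep v x} := by
  have h := c.ker_dfn.preimage_comp (Sum.elim id id : c.ι ⊕ c.ι → c.ι)
  refine (congrArg Dfn ?_).mpr h
  ext v
  constructor
  · rintro ⟨x, hx⟩
    exact ⟨x, hx, hx⟩
  · rintro ⟨x, hx, -⟩
    exact ⟨x, hx⟩

theorem Chart.DefinableSet.inter {X : Type w} {c : Chart ε X} {S T : Set X}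
    (hS : c.DefinableSet S) (hT : c.DefinableSet T) : c.DefinableSet (S ∩ T) := by
  have h := Set.Definable.inter hS hT
  refine (congrArg Dfn ?_).mpr h
  ext v
  constructor
  · rintro ⟨x, ⟨h1, h2⟩, hx⟩
    exact ⟨⟨x, h1, hx⟩, ⟨x, h2, hx⟩⟩
  · rintro ⟨⟨x, h1, hx⟩, ⟨y, h2, hy⟩⟩
    obtain rfl := c.rep_unique _ _ _ hx hy
    exact ⟨x, ⟨h1, h2⟩, hx⟩

theorem Chart.DefinableSet.compl {X : Type w} {c : Chart ε X} {S : Set X}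
    (hS : c.DefinableSet S) : c.DefinableSet Sᶜ := by
  have h := Set.Definable.sdiff c.dom_dfn hS
  refine (congrArg Dfn ?_).mpr h
  ext v
  constructor
  · rintro ⟨x, h1, hx⟩
    refine ⟨⟨x, hx⟩, ?_⟩
    rintro ⟨y, h2, hy⟩
    obtain rfl := c.rep_unique _ _ _ hx hy
    exact h1 h2
  · rintro ⟨⟨x, hx⟩, h2⟩
    exact ⟨x, fun h1 => h2 ⟨x, h1, hx⟩, hx⟩

theorem Chart.definableSet_diag {X : Type w} (c : Chart ε X) :
    (c.prod c).DefinableSet {p | p.1 = p.2} := by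
  refine (congrArg Dfn ?_).mpr c.ker_dfn
  ext v
  constructor
  · rintro ⟨⟨x, y⟩, h, hx, hy⟩
    obtain rfl : x = y := h
    exact ⟨x, hx, hy⟩
  · rintro ⟨x, hx, hy⟩
    exact ⟨(x, x), rfl, hx, hy⟩

/-- Preimages under maps that are given by a substitution of variables. -/
theorem Chart.DefinableSet.preimage_subst {X : Type w} {Y : Type w'} {c : Chart ε X}
    {d : Chart ε Y} {S : Set Y} (hS : d.DefinableSet S) (f : X → Y) (σ : d.ι → c.ι)
    (hσ : ∀ v x, c.rep v x → d.rep (v ∘ σ) (f x)) : c.DefinableSet (f ⁻¹' S) := by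
  have h := Set.Definable.inter c.dom_dfn (Set.Definable.preimage_comp σ hS)
  refine (congrArg Dfn ?_).mpr h
  ext v
  constructor
  · rintro ⟨x, h1, hx⟩
    exact ⟨⟨x, hx⟩, f x, h1, hσ _ _ hx⟩
  · rintro ⟨⟨x, hx⟩, y, h1, hy⟩
    obtain rfl := d.rep_unique _ _ _ (hσ _ _ hx) hy
    exact ⟨x, h1, hx⟩

/-- Projections of definable sets are definable: an existential quantifier over a presented set is
one over the tuples that represent its elements. -/
theorem Chart.DefinableSet.proj {X : Type w} {Y : Type w'} {c : Chart ε X}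
    {d : Chart ε Y} {S : Set (X × Y)} (hS : (c.prod d).DefinableSet S) :
    c.DefinableSet {x | ∃ y, (x, y) ∈ S} := by
  have := c.finite
  have := (c.prod d).finite
  have h := Set.Definable.image_comp hS (Sum.inl : c.ι → (c.prod d).ι)
  refine (congrArg Dfn ?_).mpr h
  ext v
  constructor
  · rintro ⟨x, ⟨y, h1⟩, hx⟩
    obtain ⟨w, hw⟩ := d.rep_surj y
    exact ⟨Sum.elim v w, ⟨(x, y), h1, hx, hw⟩, rfl⟩
  · rintro ⟨w, ⟨⟨x, y⟩, h1, hx, hy⟩, rfl⟩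
    exact ⟨x, ⟨y, h1⟩, hx⟩

theorem dfn_const {α : Type} (i : α) (a : Carrier ε) : Dfn {v : α → Carrier ε | v i = a} := by
  refine ⟨FirstOrder.Language.Term.equal (FirstOrder.Language.Term.var i)
    (FirstOrder.Language.Constants.term (lang.con (⟨a, trivial⟩ : (Set.univ : Set (Carrier ε))))),
    ?_⟩
  ext v
  simp [FirstOrder.Language.Formula.realize_equal]

theorem Chart.definableSet_singleton {X : Type w} (c : Chart ε X) (a : X) :
    c.DefinableSet {x | x = a} := by
  have := c.finite
  have := Fintype.ofFinite c.ι
  obtain ⟨w, hw⟩ := c.rep_surj a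
  have h1 : Dfn (⋂ i ∈ (Finset.univ : Finset c.ι),
      {v : c.ι ⊕ c.ι → Carrier ε | v (Sum.inr i) = w i}) :=
    Set.definable_biInter_finset (fun i => dfn_const (Sum.inr i) (w i)) _
  have h := Set.Definable.image_comp (Set.Definable.inter h1 c.ker_dfn)
    (Sum.inl : c.ι → c.ι ⊕ c.ι)
  refine (congrArg Dfn ?_).mpr h
  ext v
  constructor
  · rintro ⟨x, rfl, hx⟩
    refine ⟨Sum.elim v w, ⟨by simp, x, hx, hw⟩, rfl⟩
  · rintro ⟨v, ⟨h2, x, hx, hx'⟩, rfl⟩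
    have : v ∘ Sum.inr = w := by
      funext i
      simpa using Set.mem_iInter₂.1 h2 i (Finset.mem_univ i)
    rw [this] at hx'
    exact ⟨x, c.rep_unique _ _ _ hx' hw, hx⟩

instance : HasChart ε K := ⟨chartK ε⟩

instance {X : Type w} {Y : Type w'} [HasChart ε X] [HasChart ε Y] : HasChart ε (X × Y) :=
  ⟨(ch ε X).prod (ch ε Y)⟩

noncomputable instance {X : Type w} (c : Chart ε X) : HasChart ε (Hyp c) := ⟨chartHyp c⟩

/-- The two truth values, represented by `1` and `0`. With this presentation, definable predicates
are the same as definable maps to `Prop`. -/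
instance : HasChart ε Prop where
  chart :=
    { ι := Unit
      finite := inferInstance
      rep := fun v p => (p ∧ v () = Sum.inl 1) ∨ (¬ p ∧ v () = Sum.inl 0)
      rep_unique := by
        rintro v p q (⟨hp, h⟩ | ⟨hp, h⟩) (⟨hq, h'⟩ | ⟨hq, h'⟩)
        · simp [hp, hq]
        · exact absurd (Sum.inl_injective (h.symm.trans h')) one_ne_zero
        · exact absurd (Sum.inl_injective (h'.symm.trans h)) one_ne_zero
        · simp [hp, hq]
      rep_surj := fun p => by
        by_cases hp : p
        · exact ⟨fun _ => Sum.inl 1, Or.inl ⟨hp, rfl⟩⟩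
        · exact ⟨fun _ => Sum.inl 0, Or.inr ⟨hp, rfl⟩⟩
      ker_dfn := by
        have h := ((dfn_const (ε := ε) (Sum.inl () : Unit ⊕ Unit) (Sum.inl 1)).inter
          (dfn_const (ε := ε) (Sum.inr () : Unit ⊕ Unit) (Sum.inl 1))).union
          ((dfn_const (ε := ε) (Sum.inl () : Unit ⊕ Unit) (Sum.inl 0)).inter
          (dfn_const (ε := ε) (Sum.inr () : Unit ⊕ Unit) (Sum.inl 0)))
        refine (congrArg Dfn ?_).mpr h
        ext v
        constructor
        · rintro ⟨p, ⟨hp, h1⟩ | ⟨hp, h1⟩, ⟨hp', h2⟩ | ⟨hp', h2⟩⟩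
          · exact Or.inl ⟨h1, h2⟩
          · exact absurd hp hp'
          · exact absurd hp' hp
          · exact Or.inr ⟨h1, h2⟩
        · rintro (⟨h1, h2⟩ | ⟨h1, h2⟩)
          · exact ⟨True, Or.inl ⟨trivial, h1⟩, Or.inl ⟨trivial, h2⟩⟩
          · exact ⟨False, Or.inr ⟨id, h1⟩, Or.inr ⟨id, h2⟩⟩ }

variable {X : Type w} {Y : Type w'} {Z : Type w''} [HasChart ε X] [HasChart ε Y] [HasChart ε Z]

variable (ε) in
/-- A subset of `X` is definable (with parameters). -/
def DefSet (S : Set X) : Prop := (ch ε X).DefinableSet S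

/-- A map is definable (with parameters) if its graph is. The relation `ε` is implicit, because
`fun_prop` takes the first explicit argument that is a function for the one under consideration. -/
@[fun_prop]
def DefMap (f : X → Y) : Prop := DefSet ε {p : X × Y | f p.1 = p.2}

theorem defSet_preimage_fst {S : Set X} (hS : DefSet ε S) :
    DefSet ε (Prod.fst ⁻¹' S : Set (X × Y)) :=
  Chart.DefinableSet.preimage_subst hS _ Sum.inl fun _ _ h => h.1

theorem defSet_preimage_snd {S : Set Y} (hS : DefSet ε S) :
    DefSet ε (Prod.snd ⁻¹' S : Set (X × Y)) :=
  Chart.DefinableSet.preimage_subst hS _ Sum.inr fun _ _ h => h.2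

theorem DefSet.inter {S T : Set X} (hS : DefSet ε S) (hT : DefSet ε T) : DefSet ε (S ∩ T) :=
  Chart.DefinableSet.inter hS hT

theorem DefSet.compl {S : Set X} (hS : DefSet ε S) : DefSet ε Sᶜ :=
  Chart.DefinableSet.compl hS

theorem DefSet.union {S T : Set X} (hS : DefSet ε S) (hT : DefSet ε T) : DefSet ε (S ∪ T) := by
  have := (hS.compl.inter hT.compl).compl
  rwa [← Set.compl_union, compl_compl] at this

theorem DefSet.preimage {S : Set Y} (hS : DefSet ε S) {f : X → Y} (hf : DefMap (ε := ε) f) :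
    DefSet ε (f ⁻¹' S) := by
  have h : DefSet ε {x | ∃ y, (x, y) ∈ {p : X × Y | f p.1 = p.2} ∩ Prod.snd ⁻¹' S} :=
    Chart.DefinableSet.proj (hf.inter (defSet_preimage_snd hS))
  convert h using 1
  ext x
  simp

@[fun_prop]
theorem DefMap.id : DefMap (ε := ε) (fun x : X => x) := Chart.definableSet_diag _

@[fun_prop]
theorem DefMap.const (a : Y) : DefMap (ε := ε) (fun _ : X => a) := by
  have h : DefSet ε {y : Y | y = a} := Chart.definableSet_singleton _ a
  have := defSet_preimage_snd (X := X) h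
  refine (congrArg (DefSet ε) ?_).mpr this
  ext p
  simp [eq_comm]

@[fun_prop]
theorem DefMap.comp {g : Y → Z} {f : X → Y} (hg : DefMap (ε := ε) g) (hf : DefMap (ε := ε) f) :
    DefMap (ε := ε) (fun x => g (f x)) := by
  have h1 : DefSet ε {q : (X × Z) × Y | f q.1.1 = q.2} :=
    Chart.DefinableSet.preimage_subst (d := ch ε (X × Y)) (c := ch ε ((X × Z) × Y)) hf
      (fun q => (q.1.1, q.2)) (Sum.map Sum.inl _root_.id) fun _ _ h => ⟨h.1.1, h.2⟩
  have h2 : DefSet ε {q : (X × Z) × Y | g q.2 = q.1.2} :=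
    Chart.DefinableSet.preimage_subst (d := ch ε (Y × Z)) (c := ch ε ((X × Z) × Y)) hg
      (fun q => (q.2, q.1.2)) (Sum.elim Sum.inr (Sum.inl ∘ Sum.inr)) fun _ _ h => ⟨h.2, h.1.2⟩
  have h : DefSet ε {x | ∃ y, (x, y) ∈ _} := Chart.DefinableSet.proj (h1.inter h2)
  refine (congrArg (DefSet ε) ?_).mpr h
  ext p
  simp

@[fun_prop]
theorem DefMap.prodMk {f : X → Y} {g : X → Z} (hf : DefMap (ε := ε) f) (hg : DefMap (ε := ε) g) :
    DefMap (ε := ε) (fun x => (f x, g x)) := by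
  have h1 : DefSet ε {q : X × (Y × Z) | f q.1 = q.2.1} :=
    Chart.DefinableSet.preimage_subst (d := ch ε (X × Y)) (c := ch ε (X × (Y × Z))) hf
      (fun q => (q.1, q.2.1)) (Sum.map _root_.id Sum.inl) fun _ _ h => ⟨h.1, h.2.1⟩
  have h2 : DefSet ε {q : X × (Y × Z) | g q.1 = q.2.2} :=
    Chart.DefinableSet.preimage_subst (d := ch ε (X × Z)) (c := ch ε (X × (Y × Z))) hg
      (fun q => (q.1, q.2.2)) (Sum.map _root_.id Sum.inr) fun _ _ h => ⟨h.1, h.2.2⟩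
  refine (congrArg (DefSet ε) ?_).mpr (h1.inter h2)
  ext p
  simp [Prod.ext_iff]

/-- A map that is given on representing tuples by a substitution of variables is definable. -/
theorem DefMap.of_subst {f : X → Y} (σ : (ch ε Y).ι → (ch ε X).ι)
    (hσ : ∀ v x, (ch ε X).rep v x → (ch ε Y).rep (v ∘ σ) (f x)) : DefMap (ε := ε) f := by
  have h := Chart.DefinableSet.preimage_subst (c := ch ε (X × Y)) (DefMap.id (ε := ε) (X := Y))
    (fun q => (f q.1, q.2)) (Sum.map σ _root_.id) fun _ _ h => ⟨hσ _ _ h.1, h.2⟩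
  exact h

theorem defMap_fst : DefMap (ε := ε) (Prod.fst : X × Y → X) :=
  DefMap.of_subst Sum.inl fun _ _ h => h.1

theorem defMap_snd : DefMap (ε := ε) (Prod.snd : X × Y → Y) :=
  DefMap.of_subst Sum.inr fun _ _ h => h.2

@[fun_prop]
theorem DefMap.fst {f : X → Y × Z} (hf : DefMap (ε := ε) f) : DefMap (ε := ε) (fun x => (f x).1) :=
  defMap_fst.comp hf

@[fun_prop]
theorem DefMap.snd {f : X → Y × Z} (hf : DefMap (ε := ε) f) : DefMap (ε := ε) (fun x => (f x).2) :=
  defMap_snd.comp hf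

/-- Definable predicates are the same as definable subsets. -/
theorem defMap_prop_iff {p : X → Prop} : DefMap (ε := ε) p ↔ DefSet ε {x | p x} := by
  constructor
  · intro h
    have h1 : DefSet ε {q : Prop | q = True} := Chart.definableSet_singleton _ _
    have := h1.preimage h
    convert this using 1
    ext x
    simp
  · intro h
    have h1 : DefSet ε {q : Prop | q = True} := Chart.definableSet_singleton _ _
    have h2 := ((defSet_preimage_fst h).inter (defSet_preimage_snd h1)).union
      ((defSet_preimage_fst h.compl).inter (defSet_preimage_snd h1.compl))
    refine (congrArg (DefSet ε) ?_).mpr h2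
    ext ⟨x, q⟩
    by_cases hp : p x <;> by_cases hq : q <;> simp [hp, hq]

theorem DefMap.defSet {p : X → Prop} (h : DefMap (ε := ε) p) : DefSet ε {x | p x} :=
  defMap_prop_iff.1 h

theorem DefSet.defMap {S : Set X} (h : DefSet ε S) : DefMap (ε := ε) (fun x => x ∈ S) :=
  defMap_prop_iff.2 h

@[fun_prop]
theorem DefMap.and {p q : X → Prop} (hp : DefMap (ε := ε) p) (hq : DefMap (ε := ε) q) :
    DefMap (ε := ε) (fun x => p x ∧ q x) :=
  defMap_prop_iff.2 (hp.defSet.inter hq.defSet)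

@[fun_prop]
theorem DefMap.or {p q : X → Prop} (hp : DefMap (ε := ε) p) (hq : DefMap (ε := ε) q) :
    DefMap (ε := ε) (fun x => p x ∨ q x) :=
  defMap_prop_iff.2 (hp.defSet.union hq.defSet)

@[fun_prop]
theorem DefMap.not {p : X → Prop} (hp : DefMap (ε := ε) p) : DefMap (ε := ε) (fun x => ¬ p x) :=
  defMap_prop_iff.2 hp.defSet.compl

@[fun_prop]
theorem DefMap.iff {p q : X → Prop} (hp : DefMap (ε := ε) p) (hq : DefMap (ε := ε) q) :
    DefMap (ε := ε) (fun x => p x ↔ q x) := by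
  simp only [iff_iff_and_or_not_and_not]
  fun_prop

@[fun_prop]
theorem DefMap.exists {p : X → Y → Prop} (hp : DefMap (ε := ε) (fun q : X × Y => p q.1 q.2)) :
    DefMap (ε := ε) (fun x => ∃ y, p x y) :=
  defMap_prop_iff.2 (Chart.DefinableSet.proj hp.defSet)

@[fun_prop]
theorem DefMap.eq {f g : X → Y} (hf : DefMap (ε := ε) f) (hg : DefMap (ε := ε) g) :
    DefMap (ε := ε) (fun x => f x = g x) := by
  have h : DefSet ε {q : Y × Y | q.1 = q.2} := Chart.definableSet_diag _
  exact defMap_prop_iff.2 (h.preimage (hf.prodMk hg))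

/-- `fun_prop` has no rule for products of types. Definability of formulas with `∀` and `→` is
therefore proved after rewriting with this lemma and `imp_iff_not_or`. -/
theorem all_iff {α : Type*} {p : α → Prop} : (∀ a, p a) ↔ ¬ ∃ a, ¬ p a := by
  simp

end

section

variable {K : Type u} {F : Type v} [Field K] {ε : K → F → Prop}

instance : HasChart ε F := ⟨chartF ε⟩

variable {X : Type w} {Y : Type w'} {Z : Type w''} [HasChart ε X] [HasChart ε Y] [HasChart ε Z]

theorem DefMap.of_graph {f : X → Y} (h : DefMap (ε := ε) (fun p : X × Y => f p.1 = p.2)) :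
    DefMap (ε := ε) f := h.defSet

open Classical in
/-- The unique `x` with `P x`, or `d` if there is none. -/
noncomputable def the {α : Type*} (d : α) (P : α → Prop) : α :=
  if h : ∃! x, P x then h.choose else d

theorem the_eq {α : Type*} {d : α} {P : α → Prop} {x : α} (hx : P x) (hu : ∀ y, P y → y = x) :
    the d P = x := by
  have h : ∃! x, P x := ⟨x, hx, hu⟩
  rw [the, dif_pos h]
  exact hu _ h.choose_spec.1

theorem the_eq_default {α : Type*} {d : α} {P : α → Prop} (h : ¬ ∃ x, P x) :
    the d P = d := by
  rw [the, dif_neg fun h' => h h'.exists]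

@[fun_prop]
theorem DefMap.the {d : Y} {P : X → Y → Prop} (hP : DefMap (ε := ε) (fun q : X × Y => P q.1 q.2)) :
    DefMap (ε := ε) (fun x => the d (P x)) := by
  apply DefMap.of_graph
  have h : ∀ x y, HyperPoly.the d (P x) = y ↔
      (P x y ∧ ∀ y', P x y' → y' = y) ∨ ((¬ ∃ y, P x y ∧ ∀ y', P x y' → y' = y) ∧ d = y) := by
    intro x y
    by_cases hx : ∃! y, P x y
    · obtain ⟨z, hz, hz'⟩ := hx
      rw [the_eq hz hz']
      constructor
      · rintro rfl
        exact Or.inl ⟨hz, hz'⟩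
      · rintro (⟨h1, h2⟩ | ⟨h1, -⟩)
        · exact h2 _ hz
        · exact absurd ⟨z, hz, hz'⟩ h1
    · rw [HyperPoly.the, dif_neg hx]
      constructor
      · exact fun h => Or.inr ⟨hx, h⟩
      · rintro (h1 | h1)
        · exact absurd ⟨y, h1⟩ hx
        · exact h1.2
  simp only [h, imp_iff_not_or, all_iff]
  fun_prop

@[fun_prop]
theorem DefMap.ite {p : X → Prop} {f g : X → Y} [∀ x, Decidable (p x)] (hp : DefMap (ε := ε) p)
    (hf : DefMap (ε := ε) f) (hg : DefMap (ε := ε) g) :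
    DefMap (ε := ε) (fun x => if p x then f x else g x) := by
  apply DefMap.of_graph
  have h : ∀ x y, (if p x then f x else g x) = y ↔ (p x ∧ f x = y) ∨ (¬ p x ∧ g x = y) := by
    intro x y
    by_cases hx : p x <;> simp [hx]
  simp only [h]
  fun_prop

/-! ### Field operations -/

/-- The interpretations of the relation symbols, in arbitrary variables, are definable. -/
theorem dfn_rel {α : Type} {m : ℕ} (r : Sym m) (i : Fin m → α) :
    Dfn {v : α → Carrier ε | (instStructureCarrier ε).RelMap r (fun k => v (i k))} := by
  refine Set.Definable.mono (A := ∅) ?_ (Set.empty_subset _)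
  rw [Set.empty_definable_iff]
  refine ⟨FirstOrder.Language.Relations.formula (L := lang) (n := m) r
    (fun k => FirstOrder.Language.Term.var (i k)), ?_⟩
  ext v
  exact Iff.rfl

@[fun_prop]
theorem DefMap.add {f g : X → K} (hf : DefMap (ε := ε) f) (hg : DefMap (ε := ε) g) :
    DefMap (ε := ε) (fun x => f x + g x) := by
  have h : DefMap (ε := ε) (fun p : K × K => p.1 + p.2) := by
    have := dfn_rel (ε := ε) Sym.add (![Sum.inl (Sum.inl ()), Sum.inl (Sum.inr ()), Sum.inr ()] :
      Fin 3 → (Unit ⊕ Unit) ⊕ Unit)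
    refine (congrArg Dfn ?_).mpr this
    ext v
    constructor
    · rintro ⟨⟨⟨x, y⟩, z⟩, h, ⟨hx, hy⟩, hz⟩
      exact ⟨x, y, hx, hy, Eq.trans hz (congrArg Sum.inl (Eq.symm h))⟩
    · rintro ⟨x, y, hx, hy, hz⟩
      exact ⟨((x, y), x + y), rfl, ⟨hx, hy⟩, hz⟩
  exact h.comp (hf.prodMk hg)

@[fun_prop]
theorem DefMap.mul {f g : X → K} (hf : DefMap (ε := ε) f) (hg : DefMap (ε := ε) g) :
    DefMap (ε := ε) (fun x => f x * g x) := by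
  have h : DefMap (ε := ε) (fun p : K × K => p.1 * p.2) := by
    have := dfn_rel (ε := ε) Sym.mul (![Sum.inl (Sum.inl ()), Sum.inl (Sum.inr ()), Sum.inr ()] :
      Fin 3 → (Unit ⊕ Unit) ⊕ Unit)
    refine (congrArg Dfn ?_).mpr this
    ext v
    constructor
    · rintro ⟨⟨⟨x, y⟩, z⟩, h, ⟨hx, hy⟩, hz⟩
      exact ⟨x, y, hx, hy, Eq.trans hz (congrArg Sum.inl (Eq.symm h))⟩
    · rintro ⟨x, y, hx, hy, hz⟩
      exact ⟨((x, y), x * y), rfl, ⟨hx, hy⟩, hz⟩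
  exact h.comp (hf.prodMk hg)

@[fun_prop]
theorem DefMap.neg {f : X → K} (hf : DefMap (ε := ε) f) : DefMap (ε := ε) (fun x => - f x) := by
  apply DefMap.of_graph
  simp only [neg_eq_iff_add_eq_zero]
  fun_prop

@[fun_prop]
theorem DefMap.sub {f g : X → K} (hf : DefMap (ε := ε) f) (hg : DefMap (ε := ε) g) :
    DefMap (ε := ε) (fun x => f x - g x) := by
  simp only [sub_eq_add_neg]
  fun_prop

@[fun_prop]
theorem DefMap.inv {f : X → K} (hf : DefMap (ε := ε) f) : DefMap (ε := ε) (fun x => (f x)⁻¹) := by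
  apply DefMap.of_graph
  have h : ∀ x y : K, x⁻¹ = y ↔ (x = 0 ∧ y = 0) ∨ x * y = 1 := by
    intro x y
    by_cases hx : x = 0
    · simp [hx, eq_comm]
    · simp only [hx, false_and, false_or]
      constructor
      · rintro rfl
        exact mul_inv_cancel₀ hx
      · exact fun h => (eq_inv_of_mul_eq_one_right h).symm
  simp only [h]
  fun_prop

@[fun_prop]
theorem DefMap.div {f g : X → K} (hf : DefMap (ε := ε) f) (hg : DefMap (ε := ε) g) :
    DefMap (ε := ε) (fun x => f x / g x) := by
  simp only [div_eq_mul_inv]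
  fun_prop

/-! ### Definable finite power sets -/

/-- A predicate on `X` is hyperfinite with respect to the membership relation `E` if its extension
is that of an element of `Y`. -/
def HF {X : Type w} {Y : Type w'} (E : X → Y → Prop) (P : X → Prop) : Prop :=
  ∃ B, ∀ x, E x B ↔ P x

theorem DefMap.HF {E : Y → Z → Prop} {P : X → Y → Prop}
    (hE : DefMap (ε := ε) (fun q : Y × Z => E q.1 q.2))
    (hP : DefMap (ε := ε) (fun q : X × Y => P q.1 q.2)) :
    DefMap (ε := ε) (fun x => HF E (P x)) := by
  simp only [HyperPoly.HF, all_iff]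
  fun_prop

theorem HF.congr {X : Type w} {Y : Type w'} {E : X → Y → Prop} {P Q : X → Prop} (h : HF E P)
    (hPQ : ∀ x, P x ↔ Q x) : HF E Q := by
  obtain ⟨B, hB⟩ := h
  exact ⟨B, fun x => (hB x).trans (hPQ x)⟩

namespace IsDefFinPow

variable {E : X → Y → Prop}

theorem defMap (h : IsDefFinPow (ch ε X) (ch ε Y) E) :
    DefMap (ε := ε) (fun p : X × Y => E p.1 p.2) :=
  defMap_prop_iff.2 h.mem_definable

theorem hf_empty (h : IsDefFinPow (ch ε X) (ch ε Y) E) : HF E (fun _ => False) := by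
  obtain ⟨O, hO⟩ := h.empty
  exact ⟨O, fun x => by simp [hO x]⟩

theorem hf_union (h : IsDefFinPow (ch ε X) (ch ε Y) E) {P Q : X → Prop} (hP : HF E P)
    (hQ : HF E Q) : HF E (fun x => P x ∨ Q x) := by
  obtain ⟨B, hB⟩ := hP
  obtain ⟨C, hC⟩ := hQ
  obtain ⟨D, hD⟩ := h.union B C
  exact ⟨D, fun x => by rw [hD, hB, hC]⟩

theorem hf_singleton (h : IsDefFinPow (ch ε X) (ch ε Y) E) (a : X) : HF E (fun x => x = a) :=
  h.singleton a

/-- Induction over hyperfinite sets. -/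
theorem ind (h : IsDefFinPow (ch ε X) (ch ε Y) E) {U : Y → Prop} (hU : DefMap (ε := ε) U)
    (h0 : ∀ O, (∀ x, ¬ E x O) → U O)
    (hs : ∀ a B C, U B → (∀ x, E x C ↔ E x B ∨ x = a) → U C) (B : Y) : U B := by
  have := h.induction {B | U B} hU.defSet h0 hs
  exact (Set.ext_iff.1 this B).2 trivial

/-- A definable union of hyperfinite sets over a hyperfinite index set is hyperfinite. -/
theorem hf_biUnion {X' : Type w''} {Y' : Type w₃} [HasChart ε X'] [HasChart ε Y']
    {E' : X' → Y' → Prop} (h : IsDefFinPow (ch ε X) (ch ε Y) E)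
    (h' : IsDefFinPow (ch ε X') (ch ε Y') E') {R : X → X' → Prop}
    (hR : DefMap (ε := ε) (fun q : X × X' => R q.1 q.2)) (B : Y)
    (hB : ∀ x, E x B → HF E' (R x)) : HF E' (fun z => ∃ x, E x B ∧ R x z) := by
  revert hB
  have hE := h.defMap
  have hE' := h'.defMap
  refine h.ind (U := fun B => (∀ x, E x B → HF E' (R x)) → HF E' (fun z => ∃ x, E x B ∧ R x z))
    ?_ ?_ ?_ B
  · simp only [HF, imp_iff_not_or, all_iff]
    fun_prop
  · intro O hO _
    exact h'.hf_empty.congr fun x => by simp [hO]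
  · intro a B C hB hC h1
    refine (h'.hf_union (hB fun x hx => h1 x ((hC x).2 (Or.inl hx)))
      (h1 a ((hC a).2 (Or.inr rfl)))).congr fun z => ?_
    simp only [hC]
    constructor
    · rintro (⟨x, hx, hz⟩ | hz)
      · exact ⟨x, Or.inl hx, hz⟩
      · exact ⟨a, Or.inr rfl, hz⟩
    · rintro ⟨x, hx | rfl, hz⟩
      · exact Or.inl ⟨x, hx, hz⟩
      · exact Or.inr hz

/-- A definable subset of a hyperfinite set is hyperfinite. -/
theorem hf_sep (h : IsDefFinPow (ch ε X) (ch ε Y) E) {P Q : X → Prop} (hP : HF E P)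
    (hQ : DefMap (ε := ε) Q) : HF E (fun x => P x ∧ Q x) := by
  obtain ⟨B, hB⟩ := hP
  refine (h.hf_biUnion h (R := fun x z => Q x ∧ z = x) (by fun_prop) B ?_).congr fun x => ?_
  · intro x _
    by_cases hx : Q x
    · exact (h.hf_singleton x).congr fun z => by simp [hx]
    · exact h.hf_empty.congr fun z => by simp [hx]
  · rw [← hB]
    constructor
    · rintro ⟨x, h1, h2, rfl⟩
      exact ⟨h1, h2⟩
    · rintro ⟨h1, h2⟩
      exact ⟨x, h1, h2, rfl⟩

theorem hf_image {X' : Type w''} {Y' : Type w₃} [HasChart ε X'] [HasChart ε Y']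
    {E' : X' → Y' → Prop} (h : IsDefFinPow (ch ε X) (ch ε Y) E)
    (h' : IsDefFinPow (ch ε X') (ch ε Y') E') {P : X → Prop} (hP : HF E P) {f : X → X'}
    (hf : DefMap (ε := ε) f) : HF E' (fun z => ∃ x, P x ∧ z = f x) := by
  obtain ⟨B, hB⟩ := hP
  refine (h.hf_biUnion h' (R := fun x z => z = f x) (by fun_prop) B ?_).congr fun x => ?_
  · exact fun x _ => h'.hf_singleton _
  · simp only [hB]

end IsDefFinPow

end

section

variable {K : Type u} {F : Type v} [Field K] {ε : K → F → Prop}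
variable {X : Type w} {Y : Type w'} {Z : Type w''} [HasChart ε X] [HasChart ε Y] [HasChart ε Z]

/-! ### The internal natural numbers as an ordered monoid with induction -/

theorem DefMap.mem_base : DefMap (ε := ε) (fun p : K × F => ε p.1 p.2) := by
  rw [defMap_prop_iff]
  have := dfn_rel (ε := ε) Sym.mem (![Sum.inl (), Sum.inr ()] : Fin 2 → Unit ⊕ Unit)
  refine (congrArg Dfn ?_).mpr this
  ext v
  constructor
  · rintro ⟨⟨x, A⟩, h, hx, hA⟩
    exact ⟨x, A, hx, hA, h⟩
  · rintro ⟨x, A, hx, hA, h⟩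
    exact ⟨(x, A), h, hx, hA⟩

@[fun_prop]
theorem DefMap.mem_N {f : X → K} (hf : DefMap (ε := ε) f) :
    DefMap (ε := ε) (fun x => f x ∈ N ε) := by
  have hE := DefMap.mem_base (ε := ε)
  have h : DefMap (ε := ε) (fun x => x ∈ N ε) := by
    simp only [N, Set.mem_ofPred_eq, imp_iff_not_or, all_iff, ne_eq]
    fun_prop
  exact h.comp hf

@[fun_prop]
theorem DefMap.mem_Seg {f g : X → K} (hf : DefMap (ε := ε) f) (hg : DefMap (ε := ε) g) :
    DefMap (ε := ε) (fun x => f x ∈ Seg ε (g x)) := by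
  simp only [Seg, Set.mem_ofPred_eq, ne_eq]
  fun_prop

theorem IsDefFinPow.hf_image2 (h : IsDefFinPow (ch ε K) (ch ε F) ε) {P Q : K → Prop}
    (hP : HF ε P) (hQ : HF ε Q) {f : K → K → K}
    (hf : DefMap (ε := ε) (fun p : K × K => f p.1 p.2)) :
    HF ε (fun z => ∃ x, P x ∧ ∃ y, Q y ∧ z = f x y) := by
  obtain ⟨B, hB⟩ := hP
  obtain ⟨C, hC⟩ := hQ
  have hE := h.defMap
  refine (h.hf_biUnion h (R := fun x z => ∃ y, ε y C ∧ z = f x y) (by fun_prop) B ?_).congr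
    fun x => ?_
  · exact fun x _ => h.hf_image h (f := f x) ⟨C, fun _ => Iff.rfl⟩ (by fun_prop)
  · simp only [hB, hC]

theorem notMem_Seg_self {i : K} : i ∉ Seg ε i := fun h => h.2.1 rfl

namespace DefCharZero

theorem pow (hK : DefCharZero ε) : IsDefFinPow (ch ε K) (ch ε F) ε := hK.isDefFinPow

/-- The field is not hyperfinite: otherwise it would witness `-1 ∈ N`. -/
theorem not_hf_univ (hK : DefCharZero ε) : ¬ HF ε (fun _ => True) := by
  rintro ⟨A, hA⟩
  exact hK.neg_one_notMem ⟨A, by simp [hA]⟩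

theorem exists_not_of_hf (hK : DefCharZero ε) {P : K → Prop} (hP : HF ε P) : ∃ t, ¬ P t := by
  by_contra! h
  exact hK.not_hf_univ (hP.congr fun x => by simp [h x])

theorem zero_mem (hK : DefCharZero ε) : (0 : K) ∈ N ε := by
  obtain ⟨A, hA⟩ := hK.pow.hf_singleton 0
  exact ⟨A, by simp [hA]⟩

theorem succ_mem (hK : DefCharZero ε) {x : K} (hx : x ∈ N ε) : x + 1 ∈ N ε := by
  obtain ⟨A, h0, hxA, hA⟩ := hx
  obtain ⟨B, hB⟩ := hK.pow.hf_union ⟨A, fun _ => Iff.rfl⟩ (hK.pow.hf_singleton (x + 1))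
  refine ⟨B, by simp [hB, h0], by simp [hB], fun z hz => ?_⟩
  simp only [hB] at hz ⊢
  rcases hz with hz | rfl
  · refine ⟨fun h => Or.inl ((hA z hz).1 h), fun _ => ?_⟩
    by_cases h : z = x
    · exact Or.inr (by rw [h])
    · exact Or.inl ((hA z hz).2 h)
  · refine ⟨fun _ => Or.inl (by simpa using hxA), fun h => absurd rfl h⟩

/-- Definable induction on `N`. A counterexample `x` would yield a hyperfinite nonempty set
`B` closed under predecessors; then `B - B` is closed under predecessors and successors, which puts
`-1` into `N`. -/
theorem ind (hK : DefCharZero ε) {U : K → Prop} (hU : DefMap (ε := ε) U) (h0 : U 0)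
    (hs : ∀ x ∈ N ε, U x → U (x + 1)) : ∀ x ∈ N ε, U x := by
  intro x hx
  by_contra hxU
  have hx' := hx
  obtain ⟨A, -, hxA, hA⟩ := hx
  have hB : HF ε (fun z => ε z A ∧ ¬ (U z ∧ z ∈ N ε)) :=
    hK.pow.hf_sep ⟨A, fun _ => Iff.rfl⟩ (by fun_prop)
  have hpred : ∀ z, ε z A ∧ ¬ (U z ∧ z ∈ N ε) → ε (z - 1) A ∧ ¬ (U (z - 1) ∧ z - 1 ∈ N ε) := by
    rintro z ⟨hz, hzU⟩
    have hz0 : z ≠ 0 := by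
      rintro rfl
      exact hzU ⟨h0, hK.zero_mem⟩
    refine ⟨(hA z hz).1 hz0, fun h => hzU ?_⟩
    have h1 := hs _ h.2 h.1
    have h2 := hK.succ_mem h.2
    rw [sub_add_cancel] at h1 h2
    exact ⟨h1, h2⟩
  obtain ⟨D, hD⟩ := hK.pow.hf_image2 hB hB (f := fun a b => a - b) (by fun_prop)
  have hx2 : ε x A ∧ ¬ (U x ∧ x ∈ N ε) := ⟨hxA, fun h => hxU h.1⟩
  apply hK.neg_one_notMem
  refine ⟨D, (hD _).2 ⟨x, hx2, x, hx2, by simp⟩, (hD _).2 ⟨x - 1, hpred x hx2, x, hx2, by simp⟩,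
    fun z hz => ?_⟩
  obtain ⟨a, ha, b, hb, rfl⟩ := (hD z).1 hz
  exact ⟨fun _ => (hD _).2 ⟨a - 1, hpred a ha, b, hb, by ring⟩,
    fun _ => (hD _).2 ⟨a, ha, b - 1, hpred b hb, by ring⟩⟩

theorem one_mem (hK : DefCharZero ε) : (1 : K) ∈ N ε := by
  simpa using hK.succ_mem hK.zero_mem

theorem add_mem (hK : DefCharZero ε) {x y : K} (hx : x ∈ N ε) (hy : y ∈ N ε) : x + y ∈ N ε := by
  refine hK.ind (U := fun y => x + y ∈ N ε) (by fun_prop) (by simpa using hx) ?_ y hy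
  intro y _ h
  rw [← add_assoc]
  exact hK.succ_mem h

theorem pred_mem (hK : DefCharZero ε) {x : K} (hx : x ∈ N ε) (hx0 : x ≠ 0) : x - 1 ∈ N ε := by
  have := hK.ind (U := fun x => x = 0 ∨ x - 1 ∈ N ε) (by fun_prop) (Or.inl rfl)
    (fun x hx _ => Or.inr (by simpa using hx)) x hx
  exact this.resolve_left hx0

theorem eq_zero_of_neg_mem (hK : DefCharZero ε) {x : K} (hx : x ∈ N ε) (hx' : -x ∈ N ε) :
    x = 0 := by
  by_contra h
  have := hK.add_mem (hK.pred_mem hx h) hx'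
  exact hK.neg_one_notMem (by convert this using 1; ring)

/-- The order on `N` given by `x ≤ y ↔ y - x ∈ N` is total. -/
theorem total (hK : DefCharZero ε) {x y : K} (hx : x ∈ N ε) (hy : y ∈ N ε) :
    y - x ∈ N ε ∨ x - y ∈ N ε := by
  refine hK.ind (U := fun y => y - x ∈ N ε ∨ x - y ∈ N ε) (by fun_prop) (by simp [hx]) ?_ y hy
  intro y hy h
  by_cases hxy : x - y = 0
  · left
    have : y + 1 - x = 1 := by linear_combination -hxy
    rw [this]
    exact hK.one_mem
  · rcases h with h | h
    · left
      have := hK.succ_mem h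
      convert this using 1; ring
    · right
      have := hK.pred_mem h hxy
      convert this using 1; ring

theorem mem_N_of_lt (hK : DefCharZero ε) {i n : K} (h : i ∈ Seg ε n) : n ∈ N ε := by
  simpa using hK.add_mem h.2.2 h.1

theorem notMem_Seg_zero (hK : DefCharZero ε) {i : K} : i ∉ Seg ε 0 := fun h =>
  h.2.1 (hK.eq_zero_of_neg_mem h.1 (by simpa using h.2.2))

/-- The strict order on `N` is `i ∈ Seg ε j`. -/
theorem lt_trichotomy (hK : DefCharZero ε) {i j : K} (hi : i ∈ N ε) (hj : j ∈ N ε) :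
    i ∈ Seg ε j ∨ i = j ∨ j ∈ Seg ε i := by
  by_cases h : i = j
  · exact Or.inr (Or.inl h)
  · rcases hK.total hi hj with h' | h'
    · exact Or.inl ⟨hi, h, h'⟩
    · exact Or.inr (Or.inr ⟨hj, Ne.symm h, h'⟩)

theorem lt_of_lt_of_le (hK : DefCharZero ε) {i j k : K} (hij : i ∈ Seg ε j) (hjk : k - j ∈ N ε) :
    i ∈ Seg ε k := by
  have h1 := hK.add_mem hij.2.2 hjk
  refine ⟨hij.1, ?_, by convert h1 using 1; ring⟩
  rintro rfl
  have := hK.eq_zero_of_neg_mem hij.2.2 (by simpa using hjk)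
  exact hij.2.1 (sub_eq_zero.1 this).symm

theorem lt_trans (hK : DefCharZero ε) {i j k : K} (hij : i ∈ Seg ε j) (hjk : j ∈ Seg ε k) :
    i ∈ Seg ε k := hK.lt_of_lt_of_le hij hjk.2.2

theorem le_of_not_lt (hK : DefCharZero ε) {i j : K} (hi : i ∈ N ε) (hj : j ∈ N ε)
    (h : i ∉ Seg ε j) : i - j ∈ N ε := by
  rcases hK.lt_trichotomy hi hj with h' | rfl | h'
  · exact absurd h' h
  · simpa using hK.zero_mem
  · exact h'.2.2

theorem mem_Seg_succ (hK : DefCharZero ε) {i n : K} (hn : n ∈ N ε) :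
    i ∈ Seg ε (n + 1) ↔ i ∈ Seg ε n ∨ i = n := by
  constructor
  · rintro ⟨hi, hin, h⟩
    by_cases h' : i = n
    · exact Or.inr h'
    · left
      have := hK.pred_mem h (sub_ne_zero.2 (Ne.symm hin))
      exact ⟨hi, h', by convert this using 1; ring⟩
  · rintro (h | rfl)
    · exact hK.lt_of_lt_of_le h (by simpa using hK.one_mem)
    · exact ⟨hn, by simp, by simpa using hK.one_mem⟩

theorem self_mem_Seg_succ (hK : DefCharZero ε) {n : K} (hn : n ∈ N ε) : n ∈ Seg ε (n + 1) :=
  (hK.mem_Seg_succ hn).2 (Or.inr rfl)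

theorem add_mem_Seg (hK : DefCharZero ε) {i j k : K} (hij : i ∈ Seg ε j) (hk : k ∈ N ε) :
    k + i ∈ Seg ε (k + j) :=
  ⟨hK.add_mem hk hij.1, fun h => hij.2.1 (add_left_cancel h), by simpa using hij.2.2⟩

theorem exists_least (hK : DefCharZero ε) {U : K → Prop} (hU : DefMap (ε := ε) U)
    (h : ∃ x ∈ N ε, U x) : ∃ x ∈ N ε, U x ∧ ∀ y ∈ Seg ε x, ¬ U y := by
  by_contra! hmin
  have key : ∀ n ∈ N ε, ∀ y, y ∈ Seg ε n → ¬ U y := by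
    refine hK.ind (by simp only [imp_iff_not_or, all_iff]; fun_prop) ?_ ?_
    · exact fun y hy => absurd hy hK.notMem_Seg_zero
    · intro n hn ih y hy hyU
      rcases (hK.mem_Seg_succ hn).1 hy with hy | rfl
      · exact ih y hy hyU
      · obtain ⟨z, hz, hzU⟩ := hmin y hn hyU
        exact ih z hz hzU
  obtain ⟨x, hx, hxU⟩ := h
  exact key _ (hK.succ_mem hx) x (hK.self_mem_Seg_succ hx) hxU

theorem hf_Seg (hK : DefCharZero ε) (n : K) : HF ε (fun i => i ∈ Seg ε n) := by
  by_cases hn : n ∈ N ε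
  · refine hK.ind (U := fun n => HF ε (fun i => i ∈ Seg ε n)) ?_ ?_ ?_ n hn
    · exact DefMap.HF hK.pow.defMap (by fun_prop)
    · exact hK.pow.hf_empty.congr fun i => by simp [hK.notMem_Seg_zero]
    · intro n hn h
      exact (hK.pow.hf_union h (hK.pow.hf_singleton n)).congr fun i => (hK.mem_Seg_succ hn).symm
  · exact hK.pow.hf_empty.congr fun i => by simpa using fun h => hn (hK.mem_N_of_lt h)

theorem hf_image_Seg (hK : DefCharZero ε) {E : X → Y → Prop}
    (h : IsDefFinPow (ch ε X) (ch ε Y) E) {f : K → X} (hf : DefMap (ε := ε) f) (n : K) :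
    HF E (fun x => ∃ i ∈ Seg ε n, x = f i) :=
  hK.pow.hf_image h (hK.hf_Seg n) hf

end DefCharZero

end

section

variable {K : Type u} {F : Type v} [Field K] {ε : K → F → Prop}
variable {X : Type w} {Y : Type w'} {Z : Type w''} [HasChart ε X] [HasChart ε Y] [HasChart ε Z]

/-! ### Codes for hyperfinite sequences -/

/-- `val` is a definable analogue of Gödel's `β`-function for sequences in `X`: `val s i` is the
`i`-th entry of the sequence coded by `s`, and initial segments of coded sequences can be prolonged
arbitrarily by one entry. -/
structure IsCoding {S : Type w'} [HasChart ε S] (val : S → K → X) : Prop where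
  nonempty : Nonempty S
  defMap : DefMap (ε := ε) (fun p : S × K => val p.1 p.2)
  extend : ∀ s, ∀ n ∈ N ε, ∀ x, ∃ s', (∀ i ∈ Seg ε n, val s' i = val s i) ∧ val s' n = x

variable (ε) in
/-- `X` has codes for hyperfinite sequences. -/
class HasCoding (X : Type w) [HasChart ε X] : Prop where
  exists_isCoding : ∃ (S : Type (max u v)) (_ : HasChart ε S) (val : S → K → X),
    IsCoding (ε := ε) val

/-- A sequence `f` of length `n` is coded by a hyperfinite set `Q` containing its values, an
element `t`, and the set of all `i + t * f i`; here `t` is chosen such that `i + t * a` determines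
`i < n` and `a ∈ Q`. -/
theorem DefCharZero.hasCoding_base (hK : DefCharZero ε) : HasCoding ε K := by
  classical
  have hE := DefMap.mem_base (ε := ε)
  have hp := hK.pow
  refine ⟨⟨F × K × F, inferInstance,
    fun s i => the 0 (fun a => ε a s.1 ∧ ε (i + s.2.1 * a) s.2.2), ?_, by fun_prop, ?_⟩⟩
  · obtain ⟨O, -⟩ := hp.empty
    exact ⟨O, 0, O⟩
  intro s n hn x
  -- the prolonged sequence as a definable function on `(n + 1)`
  set f : K → K := fun i => if i = n then x else
    the 0 (fun a => ε a s.1 ∧ ε (i + s.2.1 * a) s.2.2) with hf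
  have hfd : DefMap (ε := ε) f := by
    rw [hf]
    fun_prop
  obtain ⟨Q, hQ⟩ := hK.hf_image_Seg hp hfd (n + 1)
  have hT := hK.hf_Seg (n + 1)
  have h1 := hp.hf_image2 hT hT (f := fun i j => i - j) (by fun_prop)
  have h2 := hp.hf_image2 ⟨Q, hQ⟩ ⟨Q, hQ⟩ (f := fun i j => i - j) (by fun_prop)
  -- `t` avoids all quotients `(i - j) / (a - b)`
  obtain ⟨t, ht⟩ := hK.exists_not_of_hf
    (hp.hf_image2 h1 h2 (f := fun i j => i / j) (by fun_prop))
  have hinj : ∀ i ∈ Seg ε (n + 1), ∀ j ∈ Seg ε (n + 1), ∀ a, ε a Q → ∀ b, ε b Q →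
      i + t * a = j + t * b → a = b := by
    intro i hi j hj a ha b hb hab
    by_contra hne
    refine ht ⟨j - i, ⟨j, hj, i, hi, rfl⟩, a - b, ⟨a, (hQ a).1 ha, b, (hQ b).1 hb, rfl⟩, ?_⟩
    rw [eq_div_iff (sub_ne_zero.2 hne)]
    linear_combination hab
  obtain ⟨D, hD⟩ := hK.hf_image_Seg hp (f := fun i => i + t * f i) (by fun_prop) (n + 1)
  have hval : ∀ i ∈ Seg ε (n + 1), the 0 (fun a => ε a Q ∧ ε (i + t * a) D) = f i := by
    intro i hi
    refine the_eq ⟨(hQ _).2 ⟨i, hi, rfl⟩, (hD _).2 ⟨i, hi, rfl⟩⟩ ?_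
    rintro a ⟨haQ, haD⟩
    obtain ⟨j, hj, hj'⟩ := (hD _).1 haD
    have h3 := hinj i hi j hj a haQ (f j) ((hQ _).2 ⟨j, hj, rfl⟩) hj'
    rw [h3] at hj' ⊢
    rw [add_right_cancel hj']
  refine ⟨(Q, t, D), fun i hi => ?_, ?_⟩
  · rw [hval i ((hK.mem_Seg_succ hn).2 (Or.inl hi)), hf]
    simp only
    rw [if_neg hi.2.1]
  · rw [hval n (hK.self_mem_Seg_succ hn), hf]
    simp

theorem HasCoding.prod (hX : HasCoding ε X) (hY : HasCoding ε Y) : HasCoding ε (X × Y) := by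
  obtain ⟨S, _, val, h⟩ := hX.exists_isCoding
  obtain ⟨S', _, val', h'⟩ := hY.exists_isCoding
  have hv := h.defMap
  have hv' := h'.defMap
  obtain ⟨s₀⟩ := h.nonempty
  obtain ⟨s₀'⟩ := h'.nonempty
  refine ⟨⟨S × S', inferInstance, fun s i => (val s.1 i, val' s.2 i), ⟨(s₀, s₀')⟩, by fun_prop, ?_⟩⟩
  rintro ⟨s, s'⟩ n hn ⟨x, y⟩
  obtain ⟨r, h1, h2⟩ := h.extend s n hn x
  obtain ⟨r', h1', h2'⟩ := h'.extend s' n hn y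
  exact ⟨(r, r'), fun i hi => by simp [h1 i hi, h1' i hi], by simp [h2, h2']⟩

/-- A hyperfinite sequence of hyperfinite sets `A i` is coded by an enumeration of the pairs
`(i, x)` with `x ∈ A i`. -/
theorem HasCoding.pow (hK : DefCharZero ε) (hX : HasCoding ε X) {E : X → Y → Prop}
    (hE : IsDefFinPow (ch ε X) (ch ε Y) E) : HasCoding ε Y := by
  obtain ⟨S, _, val, h⟩ := hK.hasCoding_base.exists_isCoding
  obtain ⟨S', _, val', h'⟩ := hX.exists_isCoding
  have hv := h.defMap
  have hv' := h'.defMap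
  have hEd := hE.defMap
  obtain ⟨O, hO⟩ := hE.empty
  obtain ⟨s₀⟩ := h.nonempty
  obtain ⟨s₀'⟩ := h'.nonempty
  set V : (S × S') × K → K → Y := fun s i => the O (fun B => ∀ x, E x B ↔
    ∃ j ∈ Seg ε s.2, val s.1.1 j = i ∧ val' s.1.2 j = x) with hV
  have hVd : DefMap (ε := ε) (fun p : ((S × S') × K) × K => V p.1 p.2) := by
    simp only [hV, all_iff]
    fun_prop
  refine ⟨⟨(S × S') × K, inferInstance, V, ⟨((s₀, s₀'), 0)⟩, hVd, ?_⟩⟩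
  intro s n hn C
  classical
  set f : K → Y := fun i => if i = n then C else V s i with hf
  have hfd : DefMap (ε := ε) f := by fun_prop
  -- all pairs `(i, x)` with `i < n` and `x ∈ f i` can be enumerated, by induction on `n`, and
  -- within the induction step by induction on the hyperfinite set `f n`
  have key : ∀ n ∈ N ε, ∃ s : (S × S') × K, s.2 ∈ N ε ∧ ∀ i x,
      (∃ j ∈ Seg ε s.2, val s.1.1 j = i ∧ val' s.1.2 j = x) ↔ i ∈ Seg ε n ∧ E x (f i) := by
    refine hK.ind ?_ ?_ ?_
    · simp only [all_iff]
      fun_prop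
    · refine ⟨((s₀, s₀'), 0), hK.zero_mem, fun i x => ?_⟩
      simp [hK.notMem_Seg_zero]
    · rintro n hn ⟨s, hs, hsn⟩
      have aux : ∀ B, ∃ s : (S × S') × K, s.2 ∈ N ε ∧ ∀ i x,
          (∃ j ∈ Seg ε s.2, val s.1.1 j = i ∧ val' s.1.2 j = x) ↔
            (i ∈ Seg ε n ∧ E x (f i)) ∨ (i = n ∧ E x B) := by
        refine hE.ind ?_ ?_ ?_
        · simp only [all_iff]
          fun_prop
        · intro O hO
          refine ⟨s, hs, fun i x => ?_⟩
          rw [hsn]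
          simp [hO]
        · rintro a B C ⟨s, hs, hsB⟩ hC
          obtain ⟨r, h1, h2⟩ := h.extend s.1.1 s.2 hs n
          obtain ⟨r', h1', h2'⟩ := h'.extend s.1.2 s.2 hs a
          refine ⟨((r, r'), s.2 + 1), hK.succ_mem hs, fun i x => ?_⟩
          rw [hC, and_or_left, ← or_assoc, ← hsB]
          constructor
          · rintro ⟨j, hj, hji, hjx⟩
            rcases (hK.mem_Seg_succ hs).1 hj with hj | rfl
            · left
              exact ⟨j, hj, by rw [← h1 j hj]; exact hji, by rw [← h1' j hj]; exact hjx⟩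
            · right
              exact ⟨by rw [← hji]; exact h2, by rw [← hjx]; exact h2'⟩
          · rintro (⟨j, hj, hji, hjx⟩ | ⟨rfl, rfl⟩)
            · exact ⟨j, (hK.mem_Seg_succ hs).2 (Or.inl hj), (h1 j hj).trans hji,
                (h1' j hj).trans hjx⟩
            · exact ⟨s.2, hK.self_mem_Seg_succ hs, h2, h2'⟩
      obtain ⟨s', hs', hs'n⟩ := aux (f n)
      refine ⟨s', hs', fun i x => ?_⟩
      rw [hs'n, hK.mem_Seg_succ hn]
      constructor
      · rintro (⟨h1, h2⟩ | ⟨rfl, h2⟩)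
        · exact ⟨Or.inl h1, h2⟩
        · exact ⟨Or.inr rfl, h2⟩
      · rintro ⟨h1 | rfl, h2⟩
        · exact Or.inl ⟨h1, h2⟩
        · exact Or.inr ⟨rfl, h2⟩
  obtain ⟨s', -, hs'⟩ := key _ (hK.succ_mem hn)
  have hval : ∀ i ∈ Seg ε (n + 1), V s' i = f i := by
    intro i hi
    have h1 : ∀ x, E x (f i) ↔ ∃ j ∈ Seg ε s'.2, val s'.1.1 j = i ∧ val' s'.1.2 j = x := by
      intro x
      rw [hs']
      exact ⟨fun h => ⟨hi, h⟩, fun h => h.2⟩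
    exact the_eq h1 fun B hB => hE.extensionality _ _ fun x => (hB x).trans (h1 x).symm
  refine ⟨s', fun i hi => ?_, ?_⟩
  · rw [hval i ((hK.mem_Seg_succ hn).2 (Or.inl hi)), hf]
    simp only
    rw [if_neg hi.2.1]
  · rw [hval n (hK.self_mem_Seg_succ hn), hf]
    simp

/-! ### Existence of definable finite power sets -/

/-- The quotient of a presented set by a definable equivalence relation. -/
def Chart.quot {X : Type w} {Z : Type w'} (c : Chart ε X) (q : X → Z)
    (hq : Function.Surjective q) (hker : (c.prod c).DefinableSet {p | q p.1 = q p.2}) :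
    Chart ε Z where
  ι := c.ι
  finite := c.finite
  rep v z := ∃ x, c.rep v x ∧ q x = z
  rep_unique := by
    rintro v _ _ ⟨x, hx, rfl⟩ ⟨y, hy, rfl⟩
    rw [c.rep_unique _ _ _ hx hy]
  rep_surj z := by
    obtain ⟨x, rfl⟩ := hq z
    obtain ⟨v, hv⟩ := c.rep_surj x
    exact ⟨v, x, hv, rfl⟩
  ker_dfn := by
    refine (congrArg Dfn ?_).mpr hker
    ext v
    constructor
    · rintro ⟨_, ⟨x, hx, rfl⟩, ⟨y, hy, hxy⟩⟩
      exact ⟨(x, y), hxy.symm, hx, hy⟩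
    · rintro ⟨⟨x, y⟩, hxy, hx, hy⟩
      exact ⟨_, ⟨x, hx, rfl⟩, ⟨y, hy, Eq.symm hxy⟩⟩

theorem Chart.quot_definableSet_iff {X : Type w} {Z : Type w'} {c : Chart ε X} {q : X → Z}
    {hq : Function.Surjective q} {hker : (c.prod c).DefinableSet {p | q p.1 = q p.2}}
    {U : Set Z} : (c.quot q hq hker).DefinableSet U ↔ c.DefinableSet (q ⁻¹' U) := by
  refine iff_of_eq (congrArg Dfn ?_)
  ext v
  constructor
  · rintro ⟨_, hU, x, hx, rfl⟩
    exact ⟨x, hU, hx⟩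
  · rintro ⟨x, hU, hx⟩
    exact ⟨_, hU, x, hx, rfl⟩

theorem Chart.prod_quot_definableSet_iff {X : Type w} {Y : Type w''} {Z : Type w'}
    {d : Chart ε Y} {c : Chart ε X} {q : X → Z}
    {hq : Function.Surjective q} {hker : (c.prod c).DefinableSet {p | q p.1 = q p.2}}
    {U : Set (Y × Z)} : (d.prod (c.quot q hq hker)).DefinableSet U ↔
      (d.prod c).DefinableSet {p | (p.1, q p.2) ∈ U} := by
  refine iff_of_eq (congrArg Dfn ?_)
  ext v
  constructor
  · rintro ⟨⟨y, _⟩, hU, hy, x, hx, rfl⟩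
    exact ⟨(y, x), hU, hy, hx⟩
  · rintro ⟨⟨y, x⟩, hU, hy, hx⟩
    exact ⟨(y, q x), hU, hy, x, hx, rfl⟩

/-- The hyperfinite subsets of `X` are the sets of entries of coded sequences. -/
theorem HasCoding.exists_isDefFinPow (hK : DefCharZero ε) (hX : HasCoding ε X) :
    ∃ D : Family ε X, IsDefFinPow (ch ε X) D.chart (fun x A => x ∈ A.1) := by
  obtain ⟨S, _, val, h⟩ := hX.exists_isCoding
  have hv := h.defMap
  obtain ⟨s₀⟩ := h.nonempty
  set R : S × K → Set X := fun s => {x | ∃ i ∈ Seg ε s.2, val s.1 i = x} with hR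
  have hmem : ∀ s x, x ∈ R s ↔ ∃ i ∈ Seg ε s.2, val s.1 i = x := fun _ _ => Iff.rfl
  have hker : DefMap (ε := ε) (fun p : (S × K) × (S × K) =>
      Set.rangeFactorization R p.1 = Set.rangeFactorization R p.2) := by
    simp only [Subtype.ext_iff, Set.rangeFactorization_coe, Set.ext_iff, hmem, all_iff]
    fun_prop
  have hempty : ∀ s, s ∉ N ε → ∀ x t, x ∉ R (t, s) := by
    rintro s hs x t ⟨i, hi, -⟩
    exact hs (hK.mem_N_of_lt hi)
  -- a set of entries need not come from a length in `N`, but then it is empty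
  have hins : ∀ s a, ∃ s', s'.2 ∈ N ε ∧ ∀ x, x ∈ R s' ↔ x ∈ R s ∨ x = a := by
    intro s a
    have aux : ∀ t, ∀ m ∈ N ε, ∃ s', s'.2 ∈ N ε ∧ ∀ x, x ∈ R s' ↔ x ∈ R (t, m) ∨ x = a := by
      intro t m hm
      obtain ⟨t', h1, h2⟩ := h.extend t m hm a
      refine ⟨(t', m + 1), hK.succ_mem hm, fun x => ?_⟩
      simp only [hmem, hK.mem_Seg_succ hm]
      constructor
      · rintro ⟨i, hi | rfl, rfl⟩
        · exact Or.inl ⟨i, hi, (h1 i hi).symm⟩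
        · exact Or.inr h2
      · rintro (⟨i, hi, rfl⟩ | rfl)
        · exact ⟨i, Or.inl hi, h1 i hi⟩
        · exact ⟨m, Or.inr rfl, h2⟩
    by_cases hs : s.2 ∈ N ε
    · exact aux s.1 s.2 hs
    · obtain ⟨s', hs', h'⟩ := aux s₀ 0 hK.zero_mem
      refine ⟨s', hs', fun x => ?_⟩
      rw [h', or_congr_left]
      refine iff_of_false ?_ (hempty _ hs _ _)
      rintro ⟨i, hi, -⟩
      exact hK.notMem_Seg_zero hi
  have hseg : ∀ t m x, m ∈ N ε → (x ∈ R (t, m + 1) ↔ x ∈ R (t, m) ∨ x = val t m) := by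
    intro t m x hm
    simp only [hmem, hK.mem_Seg_succ hm]
    constructor
    · rintro ⟨i, hi | rfl, rfl⟩
      · exact Or.inl ⟨i, hi, rfl⟩
      · exact Or.inr rfl
    · rintro (⟨i, hi, rfl⟩ | rfl)
      · exact ⟨i, Or.inl hi, rfl⟩
      · exact ⟨m, Or.inr rfl, rfl⟩
  have hzero : ∀ t x, x ∉ R (t, 0) := fun t x ⟨i, hi, _⟩ => hK.notMem_Seg_zero hi
  refine ⟨⟨Set.range R, (ch ε (S × K)).quot (Set.rangeFactorization R)
    Set.rangeFactorization_surjective hker.defSet⟩, ?_, ?_, ?_, ?_, ?_, ?_⟩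
  · refine (Chart.prod_quot_definableSet_iff (hq := Set.rangeFactorization_surjective)
      (hker := hker.defSet)).2 ?_
    have : DefMap (ε := ε) (fun p : X × (S × K) => p.1 ∈ R p.2) := by
      simp only [hmem]
      fun_prop
    exact this.defSet
  · exact fun B C hBC => Subtype.ext (Set.ext hBC)
  · exact ⟨⟨_, (s₀, 0), rfl⟩, hzero s₀⟩
  · intro a
    obtain ⟨s', -, h'⟩ := hins (s₀, 0) a
    exact ⟨⟨_, s', rfl⟩, fun x => by simp [h', hzero]⟩
  · rintro ⟨_, s, rfl⟩ ⟨_, ⟨t, m⟩, rfl⟩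
    have key : ∀ m ∈ N ε, ∃ s', ∀ x, x ∈ R s' ↔ x ∈ R s ∨ x ∈ R (t, m) := by
      refine hK.ind ?_ ?_ ?_
      · simp only [hmem, all_iff]
        fun_prop
      · exact ⟨s, fun x => by simp [hzero]⟩
      · rintro m hm ⟨s', hs'⟩
        obtain ⟨s'', -, h''⟩ := hins s' (val t m)
        exact ⟨s'', fun x => by rw [h'', hs', hseg _ _ _ hm, or_assoc]⟩
    by_cases hm : m ∈ N ε
    · obtain ⟨s', hs'⟩ := key m hm
      exact ⟨⟨_, s', rfl⟩, hs'⟩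
    · exact ⟨⟨_, s, rfl⟩, fun x => by simp [hempty _ hm]⟩
  · intro U hU h0 hs
    have hU' : DefSet ε (Set.rangeFactorization R ⁻¹' U) := 
      (Chart.quot_definableSet_iff (hq := Set.rangeFactorization_surjective)
        (hker := hker.defSet)).1 hU
    have hUd := hU'.defMap
    rw [Set.eq_univ_iff_forall]
    rintro ⟨_, ⟨t, m⟩, rfl⟩
    have key : ∀ m ∈ N ε, (t, m) ∈ Set.rangeFactorization R ⁻¹' U := by
      refine hK.ind (by fun_prop) ?_ ?_
      · exact h0 _ (hzero t)
      · intro m hm hmU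
        exact hs (val t m) _ _ hmU fun x => hseg t m x hm
    by_cases hm : m ∈ N ε
    · exact key m hm
    · exact h0 _ (hempty m hm · t)

/-- The family `finPow` is not the junk value of its definition. -/
theorem HasCoding.isDefFinPow (hK : DefCharZero ε) (hX : HasCoding ε X) :
    IsDefFinPow (ch ε X) (ch ε (Hyp (ch ε X))) (fun x A => x ∈ A.1) := by
  have h := hX.exists_isDefFinPow hK
  have key : ∀ D : Family ε X, D = h.choose →
      IsDefFinPow (ch ε X) D.chart (fun x A => x ∈ A.1) := by
    rintro _ rfl
    exact h.choose_spec
  exact key (finPow (ch ε X)) (dif_pos h)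

theorem HasCoding.hyp (hK : DefCharZero ε) (hX : HasCoding ε X) :
    HasCoding ε (Hyp (ch ε X)) := hX.pow hK (hX.isDefFinPow hK)

end

section

variable {K : Type u} {F : Type v} [Field K] {ε : K → F → Prop} [hK : Fact (DefCharZero ε)]
variable {X : Type w} {Y : Type w'} {Z : Type w''} [HasChart ε X] [HasChart ε Y] [HasChart ε Z]

/-! ### Hyperfinite sets and sequences -/

instance : HasCoding ε K := hK.out.hasCoding_base

instance [HasCoding ε X] [HasCoding ε Y] : HasCoding ε (X × Y) := HasCoding.prod ‹_› ‹_›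

instance [HasCoding ε X] : HasCoding ε (Hyp (ch ε X)) := HasCoding.hyp hK.out ‹_›

omit hK in
variable (ε) in
/-- A predicate is hyperfinite if its extension is an element of the definable finite power set. -/
abbrev Hyperfinite (P : X → Prop) : Prop := HF (fun x (A : Hyp (ch ε X)) => x ∈ A.1) P

@[fun_prop]
theorem DefMap.mem_hyp [HasCoding ε X] {f : Z → X} {g : Z → Hyp (ch ε X)}
    (hf : DefMap (ε := ε) f) (hg : DefMap (ε := ε) g) :
    DefMap (ε := ε) (fun z => f z ∈ (g z).1) :=
  (HasCoding.isDefFinPow (X := X) hK.out ‹_›).defMap.comp (hf.prodMk hg)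

theorem isDefFinPow_hyp (ε : K → F → Prop) [hK : Fact (DefCharZero ε)] (X : Type w) [HasChart ε X]
    [HasCoding ε X] :
    IsDefFinPow (ch ε X) (ch ε (Hyp (ch ε X))) (fun x A => x ∈ A.1) :=
  HasCoding.isDefFinPow hK.out ‹_›

/-- Induction over hyperfinite sets. -/
theorem hyp_ind [HasCoding ε X] {U : Hyp (ch ε X) → Prop} (hU : DefMap (ε := ε) U)
    (h0 : ∀ O, (∀ x, x ∉ O.1) → U O)
    (hs : ∀ a B C, U B → (∀ x, x ∈ C.1 ↔ x ∈ B.1 ∨ x = a) → U C) (B : Hyp (ch ε X)) : U B :=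
  (isDefFinPow_hyp ε X).ind hU h0 hs B

theorem Hyperfinite.sep [HasCoding ε X] {P Q : X → Prop} (hP : Hyperfinite ε P)
    (hQ : DefMap (ε := ε) Q) : Hyperfinite ε (fun x => P x ∧ Q x) :=
  (isDefFinPow_hyp ε X).hf_sep hP hQ

theorem Hyperfinite.union [HasCoding ε X] {P Q : X → Prop} (hP : Hyperfinite ε P)
    (hQ : Hyperfinite ε Q) : Hyperfinite ε (fun x => P x ∨ Q x) :=
  (isDefFinPow_hyp ε X).hf_union hP hQ

theorem hyperfinite_empty [HasCoding ε X] : Hyperfinite ε (fun _ : X => False) :=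
  (isDefFinPow_hyp ε X).hf_empty

theorem hyperfinite_singleton [HasCoding ε X] (a : X) : Hyperfinite ε (fun x => x = a) :=
  (isDefFinPow_hyp ε X).hf_singleton a

theorem Hyperfinite.biUnion [HasCoding ε X] [HasCoding ε Y] {P : X → Prop} (hP : Hyperfinite ε P)
    {R : X → Y → Prop} (hR : DefMap (ε := ε) (fun q : X × Y => R q.1 q.2))
    (h : ∀ x, P x → Hyperfinite ε (R x)) : Hyperfinite ε (fun y => ∃ x, P x ∧ R x y) := by
  obtain ⟨B, hB⟩ := hP
  refine ((isDefFinPow_hyp ε X).hf_biUnion (isDefFinPow_hyp ε Y) hR B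
    (fun x hx => h x ((hB x).1 hx))).congr fun y => ?_
  simp only [hB]

theorem Hyperfinite.image [HasCoding ε X] [HasCoding ε Y] {P : X → Prop} (hP : Hyperfinite ε P)
    {f : X → Y} (hf : DefMap (ε := ε) f) : Hyperfinite ε (fun y => ∃ x, P x ∧ y = f x) :=
  (isDefFinPow_hyp ε X).hf_image (isDefFinPow_hyp ε Y) hP hf

theorem hyperfinite_image_Seg [HasCoding ε X] {f : K → X} (hf : DefMap (ε := ε) f) (n : K) :
    Hyperfinite ε (fun x => ∃ i ∈ Seg ε n, x = f i) :=
  hK.out.hf_image_Seg (isDefFinPow_hyp ε X) hf n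

/-- The `i`-th entry of a sequence (`d` if `i` is not a valid index). -/
noncomputable def entry (d : X) (f : Hyp (ch ε (K × X))) (i : K) : X :=
  the d fun x => (i, x) ∈ f.1

@[fun_prop]
theorem DefMap.entry [HasCoding ε X] {d : X} {f : Z → Hyp (ch ε (K × X))} {i : Z → K}
    (hf : DefMap (ε := ε) f) (hi : DefMap (ε := ε) i) :
    DefMap (ε := ε) (fun z => entry d (f z) (i z)) := by
  simp only [HyperPoly.entry]
  fun_prop

@[fun_prop]
theorem DefMap.isSeq [HasCoding ε X] {S : Set X} (hS : DefMap (ε := ε) (fun x => x ∈ S))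
    {m : Z → K} {f : Z → Hyp (ch ε (K × X))} (hm : DefMap (ε := ε) m) (hf : DefMap (ε := ε) f) :
    DefMap (ε := ε) (fun z => IsSeq (c := ch ε X) (m z) S (f z)) := by
  simp only [IsSeq, ExistsUnique, imp_iff_not_or, all_iff]
  fun_prop

section
omit hK

variable {n : K} {S : Set X} {f g : Hyp (ch ε (K × X))} {i : K} {d x : X}

theorem IsSeq.eq_of_mem (h : IsSeq (c := ch ε X) n S f) {y : X} (hx : (i, x) ∈ f.1)
    (hy : (i, y) ∈ f.1) : x = y :=
  (h.2 i (h.1 _ hx).1).unique hx hy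

theorem IsSeq.entry_eq (h : IsSeq (c := ch ε X) n S f) (hx : (i, x) ∈ f.1) : entry d f i = x :=
  the_eq hx fun _ hy => h.eq_of_mem hy hx

theorem IsSeq.entry_mem (h : IsSeq (c := ch ε X) n S f) (hi : i ∈ Seg ε n) :
    (i, entry d f i) ∈ f.1 := by
  obtain ⟨x, hx, -⟩ := h.2 i hi
  rwa [h.entry_eq hx]

theorem IsSeq.entry_mem_set (h : IsSeq (c := ch ε X) n S f) (hi : i ∈ Seg ε n) :
    entry d f i ∈ S :=
  (h.1 _ (h.entry_mem hi)).2

theorem IsSeq.ext (hf : IsSeq (c := ch ε X) n S f) (hg : IsSeq (c := ch ε X) n S g)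
    (h : ∀ i ∈ Seg ε n, entry d f i = entry d g i) : f = g := by
  refine Subtype.ext (Set.ext ?_)
  rintro ⟨i, x⟩
  constructor
  · intro hx
    have hi := (hf.1 _ hx).1
    rw [← hf.entry_eq (d := d) hx, h i hi]
    exact hg.entry_mem hi
  · intro hx
    have hi := (hg.1 _ hx).1
    rw [← hg.entry_eq (d := d) hx, ← h i hi]
    exact hf.entry_mem hi

end

/-- A definable function on `(n)` is a hyperfinite sequence. -/
theorem exists_isSeq [HasCoding ε X] {S : Set X} (d : X) {n : K} {φ : K → X}
    (hφ : DefMap (ε := ε) φ) (hS : ∀ i ∈ Seg ε n, φ i ∈ S) :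
    ∃ f : Hyp (ch ε (K × X)), IsSeq (c := ch ε X) n S f ∧ ∀ i ∈ Seg ε n, entry d f i = φ i := by
  obtain ⟨f, hf⟩ := hyperfinite_image_Seg (ε := ε) (f := fun i => (i, φ i)) (by fun_prop) n
  have hmem : ∀ i x, (i, x) ∈ f.1 ↔ i ∈ Seg ε n ∧ x = φ i := by
    intro i x
    refine (hf _).trans ?_
    simp only [Prod.mk.injEq]
    constructor
    · rintro ⟨i, hi, rfl, rfl⟩
      exact ⟨hi, rfl⟩
    · rintro ⟨hi, rfl⟩
      exact ⟨i, hi, rfl, rfl⟩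
  have hseq : IsSeq (c := ch ε X) n S f := by
    refine ⟨?_, fun i hi => ⟨φ i, (hmem _ _).2 ⟨hi, rfl⟩, fun x hx => ((hmem _ _).1 hx).2⟩⟩
    rintro ⟨i, x⟩ hq
    obtain ⟨hi, rfl⟩ := (hmem _ _).1 hq
    exact ⟨hi, hS i hi⟩
  exact ⟨f, hseq, fun i hi => hseq.entry_eq ((hmem _ _).2 ⟨hi, rfl⟩)⟩

theorem IsSeq.exists_snoc [HasCoding ε X] {S : Set X} (d : X) {n : K} (hn : n ∈ N ε)
    {f : Hyp (ch ε (K × X))} (hf : IsSeq (c := ch ε X) n S f) {x : X} (hx : x ∈ S) :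
    ∃ g : Hyp (ch ε (K × X)), IsSeq (c := ch ε X) (n + 1) S g ∧
      (∀ i ∈ Seg ε n, entry d g i = entry d f i) ∧ entry d g n = x := by
  classical
  obtain ⟨g, hg, hg'⟩ := exists_isSeq (S := S) (ε := ε) d (n := n + 1)
    (φ := fun i => if i = n then x else entry d f i) (by fun_prop) (by
      intro i hi
      rcases (hK.out.mem_Seg_succ hn).1 hi with hi | rfl
      · simp only [if_neg hi.2.1]
        exact hf.entry_mem_set hi
      · simpa using hx)
  refine ⟨g, hg, fun i hi => ?_, ?_⟩
  · rw [hg' i ((hK.out.mem_Seg_succ hn).2 (Or.inl hi)), if_neg hi.2.1]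
  · rw [hg' n (hK.out.self_mem_Seg_succ hn), if_pos rfl]

/-! ### Dickson's lemma and lexicographic minima -/

/-- Dickson's lemma. The auxiliary statement is that for every sequence `c` of bounds (where a
value outside `N` means "no bound"), some hyperfinite part of `D` dominates all `z ∈ D` that obey
the first `k` bounds; it is proved by descending induction on `k`. -/
theorem dickson [HasCoding ε Z] {D : Z → Prop} (hD : DefMap (ε := ε) D) {x : Z → K → K}
    (hx : DefMap (ε := ε) (fun p : Z × K => x p.1 p.2)) {n : K} (hn : n ∈ N ε)
    (hxN : ∀ z, D z → ∀ i ∈ Seg ε n, x z i ∈ N ε) :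
    ∃ B : Hyp (ch ε Z), (∀ y ∈ B.1, D y) ∧
      ∀ z, D z → ∃ y ∈ B.1, ∀ i ∈ Seg ε n, x z i - x y i ∈ N ε := by
  have hK := hK.out
  obtain ⟨S, _, val, h⟩ := hK.hasCoding_base.exists_isCoding
  have hv := h.defMap
  set bd : S → K → Z → Prop := fun c k z =>
    ∀ i ∈ Seg ε k, val c i ∈ N ε → val c i - x z i ∈ N ε with hbd
  set Q : S → K → Hyp (ch ε Z) → Prop := fun c k B => (∀ y ∈ B.1, D y) ∧
    ∀ z, D z → bd c k z → ∃ y ∈ B.1, bd c k y ∧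
      ∀ i ∈ Seg ε n, i ∉ Seg ε k → x z i - x y i ∈ N ε with hQ
  have hQd : DefMap (ε := ε) (fun p : S × K × Hyp (ch ε Z) => Q p.1 p.2.1 p.2.2) := by
    simp only [hQ, hbd, imp_iff_not_or, all_iff]
    fun_prop
  have hbd_succ : ∀ c k z, k ∈ N ε → (bd c (k + 1) z ↔ bd c k z ∧
      (val c k ∈ N ε → val c k - x z k ∈ N ε)) := by
    intro c k z hk
    simp only [hbd, hK.mem_Seg_succ hk]
    constructor
    · exact fun h => ⟨fun i hi => h i (Or.inl hi), h k (Or.inr rfl)⟩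
    · rintro ⟨h1, h2⟩ i (hi | rfl)
      · exact h1 i hi
      · exact h2
  have hbd_congr : ∀ c c' k z, (∀ i ∈ Seg ε k, val c' i = val c i) → bd c' k z → bd c k z := by
    intro c c' k z hc hz i hi
    rw [← hc i hi]
    exact hz i hi
  have hunion : ∀ A B : Hyp (ch ε Z), ∃ C : Hyp (ch ε Z), ∀ z, z ∈ C.1 ↔ z ∈ A.1 ∨ z ∈ B.1 :=
    fun A B => (isDefFinPow_hyp ε Z).union A B
  -- if all coordinates are bounded, a single element suffices
  have htop : ∀ c, ∃ B, Q c n B := by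
    intro c
    by_cases hz : ∃ z, D z ∧ bd c n z
    · obtain ⟨z, hz, hzb⟩ := hz
      obtain ⟨B, hB⟩ := hyperfinite_singleton (ε := ε) z
      refine ⟨B, fun y hy => by rw [(hB y).1 hy]; exact hz, fun z' _ _ =>
        ⟨z, (hB z).2 rfl, hzb, fun i hi hi' => absurd hi hi'⟩⟩
    · obtain ⟨B, hB⟩ := hyperfinite_empty (ε := ε) (X := Z)
      exact ⟨B, fun y hy => ((hB y).1 hy).elim, fun z' h1 h2 => absurd ⟨z', h1, h2⟩ hz⟩
  have hstep : ∀ k ∈ Seg ε n, (∀ c, ∃ B, Q c (k + 1) B) → ∀ c, ∃ B, Q c k B := by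
    intro k hk ih c
    have hkN := hk.1
    -- a hyperfinite part of `D` that dominates everything when there is no bound at `k`, encoded
    -- by the value `-1 ∉ N`; it still works for elements whose `k`-th coordinate is at least `j`
    obtain ⟨c', hc', hc'k⟩ := h.extend c k hkN (-1)
    obtain ⟨B, hBD, hB⟩ := ih c'
    have hmax : ∃ j ∈ N ε, ∀ y ∈ B.1, D y → j - x y k ∈ N ε := by
      refine hyp_ind (U := fun B => ∃ j ∈ N ε, ∀ y ∈ B.1, D y → j - x y k ∈ N ε) ?_ ?_ ?_ B
      · simp only [imp_iff_not_or, all_iff]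
        fun_prop
      · exact fun O hO => ⟨0, hK.zero_mem, fun y hy => absurd hy (hO y)⟩
      · rintro a B C ⟨j, hj, hjB⟩ hC
        by_cases ha : D a
        · have haN := hxN a ha k hk
          refine ⟨j + x a k, hK.add_mem hj haN, fun y hy hyD => ?_⟩
          rcases (hC y).1 hy with hy | rfl
          · have := hK.add_mem (hjB y hy hyD) haN
            convert this using 1; ring
          · simpa using hj
        · refine ⟨j, hj, fun y hy hyD => ?_⟩
          rcases (hC y).1 hy with hy | rfl
          · exact hjB y hy hyD
          · exact absurd hyD ha
    obtain ⟨j, hj, hjB⟩ := hmax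
    -- the remaining elements have one of the `k`-th coordinates `m < j`, which then serves as
    -- a bound
    have key : ∀ m ∈ N ε, ∃ C : Hyp (ch ε Z), (∀ y ∈ C.1, D y) ∧ ∀ z, D z → bd c k z →
        x z k ∈ Seg ε m → ∃ y ∈ C.1, bd c k y ∧
          ∀ i ∈ Seg ε n, i ∉ Seg ε k → x z i - x y i ∈ N ε := by
      refine hK.ind ?_ ?_ ?_
      · simp only [hbd, imp_iff_not_or, all_iff]
        fun_prop
      · obtain ⟨C, hC⟩ := hyperfinite_empty (ε := ε) (X := Z)
        exact ⟨C, fun y hy => ((hC y).1 hy).elim, fun z _ _ hz => absurd hz hK.notMem_Seg_zero⟩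
      · rintro m hm ⟨C, hCD, hC⟩
        obtain ⟨c'', hc'', hc''k⟩ := h.extend c k hkN m
        obtain ⟨B', hB'D, hB'⟩ := ih c''
        obtain ⟨C', hC'⟩ := hunion C B'
        refine ⟨C', fun y hy => ((hC' y).1 hy).elim (hCD y) (hB'D y), fun z hz hzb hzm => ?_⟩
        rcases (hK.mem_Seg_succ hm).1 hzm with hzm | hzm
        · obtain ⟨y, hy, h1⟩ := hC z hz hzb hzm
          exact ⟨y, (hC' y).2 (Or.inl hy), h1⟩
        · have hzb' : bd c'' (k + 1) z := by
            refine (hbd_succ _ _ _ hkN).2 ⟨hbd_congr _ _ _ _ (fun i hi => (hc'' i hi).symm) hzb,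
              fun _ => ?_⟩
            rw [hc''k, hzm, sub_self]
            exact hK.zero_mem
          obtain ⟨y, hy, hyb, h1⟩ := hB' z hz hzb'
          obtain ⟨hyb1, hyb2⟩ := (hbd_succ _ _ _ hkN).1 hyb
          refine ⟨y, (hC' y).2 (Or.inr hy), hbd_congr _ _ _ _ hc'' hyb1, fun i hi hik => ?_⟩
          by_cases hik' : i = k
          · rw [hik', hzm]
            rw [hc''k] at hyb2
            exact hyb2 hm
          · exact h1 i hi fun h' => ((hK.mem_Seg_succ hkN).1 h').elim hik hik'
    obtain ⟨C, hCD, hC⟩ := key j hj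
    obtain ⟨C', hC'⟩ := hunion C B
    refine ⟨C', fun y hy => ((hC' y).1 hy).elim (hCD y) (hBD y), fun z hz hzb => ?_⟩
    by_cases hzj : x z k ∈ Seg ε j
    · obtain ⟨y, hy, h1⟩ := hC z hz hzb hzj
      exact ⟨y, (hC' y).2 (Or.inl hy), h1⟩
    · have hzb' : bd c' (k + 1) z := by
        refine (hbd_succ _ _ _ hkN).2 ⟨hbd_congr _ _ _ _ (fun i hi => (hc' i hi).symm) hzb,
          fun h' => ?_⟩
        rw [hc'k] at h'
        exact absurd h' hK.neg_one_notMem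
      obtain ⟨y, hy, hyb, h1⟩ := hB z hz hzb'
      refine ⟨y, (hC' y).2 (Or.inr hy), hbd_congr _ _ _ _ hc' ((hbd_succ _ _ _ hkN).1 hyb).1,
        fun i hi hik => ?_⟩
      by_cases hik' : i = k
      · rw [hik']
        have h2 := hK.le_of_not_lt (hxN z hz k hk) hj hzj
        have h3 := hK.add_mem h2 (hjB y hy (hBD y hy))
        convert h3 using 1; ring
      · exact h1 i hi fun h' => ((hK.mem_Seg_succ hkN).1 h').elim hik hik'
  have hall : ∀ k ∈ N ε, n - k ∈ N ε → ∀ c, ∃ B, Q c (n - k) B := by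
    refine hK.ind ?_ ?_ ?_
    · simp only [imp_iff_not_or, all_iff]
      fun_prop
    · intro _ c
      rw [sub_zero]
      exact htop c
    · intro k hk ih hnk
      refine hstep _ ⟨hnk, ?_, ?_⟩ ?_
      · intro h'
        have : k + 1 = 0 := by linear_combination -h'
        have h2 : k = -1 := by linear_combination this
        exact hK.neg_one_notMem (h2 ▸ hk)
      · have := hK.succ_mem hk
        convert this using 1; ring
      · have h1 : n - (k + 1) + 1 = n - k := by ring
        rw [h1]
        exact ih (by have := hK.succ_mem hnk; rwa [h1] at this)
  obtain ⟨s⟩ := h.nonempty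
  obtain ⟨B, hBD, hB⟩ := hall n hn (by rw [sub_self]; exact hK.zero_mem) s
  rw [sub_self] at hB
  refine ⟨B, hBD, fun z hz => ?_⟩
  obtain ⟨y, hy, -, h1⟩ := hB z hz fun i hi => absurd hi hK.notMem_Seg_zero
  exact ⟨y, hy, fun i hi => h1 i hi hK.notMem_Seg_zero⟩

omit hK in
variable (ε) in
/-- The lexicographic order of sequences of length `n`. -/
def LexLT (n : K) (a b : K → K) : Prop :=
  ∃ i ∈ Seg ε n, a i ∈ Seg ε (b i) ∧ ∀ j ∈ Seg ε i, a j = b j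

omit hK in
/-- The lexicographic order of exponents is well-founded for definable sets. -/
theorem exists_lex_minimal (hK : DefCharZero ε) {D : Z → Prop} (hD : DefMap (ε := ε) D)
    {x : Z → K → K}
    (hx : DefMap (ε := ε) (fun p : Z × K => x p.1 p.2)) {n : K} (hn : n ∈ N ε)
    (hxN : ∀ z, D z → ∀ i ∈ Seg ε n, x z i ∈ N ε) (hne : ∃ z, D z) :
    ∃ z, D z ∧ ∀ y, D y → ¬ LexLT ε n (x y) (x z) := by
  have key : ∀ k ∈ N ε, n - k ∈ N ε → ∃ z, D z ∧ ∀ y, D y → ¬ LexLT ε k (x y) (x z) := by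
    refine hK.ind ?_ ?_ ?_
    · simp only [LexLT, imp_iff_not_or, all_iff]
      fun_prop
    · intro _
      obtain ⟨z, hz⟩ := hne
      refine ⟨z, hz, fun y _ => ?_⟩
      rintro ⟨i, hi, -⟩
      exact hK.notMem_Seg_zero hi
    · intro k hk ih hnk
      have hkn : n - k ∈ N ε := by
        have := hK.succ_mem hnk
        convert this using 1; ring
      obtain ⟨z, hz, hzmin⟩ := ih hkn
      have hkn' : k ∈ Seg ε n :=
        hK.lt_of_lt_of_le (hK.self_mem_Seg_succ hk) hnk
      obtain ⟨a, -, ⟨y, hy, hyz, rfl⟩, hmin⟩ := hK.exists_least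
        (U := fun a => ∃ y, D y ∧ (∀ j ∈ Seg ε k, x y j = x z j) ∧ x y k = a)
        (by simp only [imp_iff_not_or, all_iff]; fun_prop)
        ⟨x z k, hxN z hz k hkn', z, hz, fun _ _ => rfl, rfl⟩
      refine ⟨y, hy, ?_⟩
      rintro y' hy' ⟨i, hi, hlt, heq⟩
      rcases (hK.mem_Seg_succ hk).1 hi with hi | rfl
      · refine hzmin y' hy' ⟨i, hi, by rwa [hyz i hi] at hlt, fun j hj => ?_⟩
        rw [heq j hj, hyz j (hK.lt_trans hj hi)]
      · exact hmin _ hlt ⟨y', hy', fun j hj => (heq j hj).trans (hyz j hj), rfl⟩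
  exact key n hn (by rw [sub_self]; exact hK.zero_mem)

end

section

variable {K : Type u} {F : Type v} [Field K] {ε : K → F → Prop} [hK : Fact (DefCharZero ε)]
variable {Z : Type w''} [HasChart ε Z]

/-! ### Monomials -/

instance : HasCoding ε (Rel₂ ε) := inferInstanceAs (HasCoding ε (Hyp (ch ε (K × K))))

instance : HasCoding ε (Pre ε) := inferInstanceAs (HasCoding ε (Hyp (ch ε (Rel₂ ε × K))))

/-- The exponent of the variable `x_i` in the monomial `I`. -/
noncomputable abbrev expo (I : Rel₂ ε) (i : K) : K := entry (X := K) 0 I i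

@[fun_prop]
theorem DefMap.mem_Mon {n : K} {f : Z → Rel₂ ε} (hf : DefMap (ε := ε) f) :
    DefMap (ε := ε) (fun z => f z ∈ Mon ε n) := by
  have h : DefMap (ε := ε) (fun I : Rel₂ ε => IsSeq (c := ch ε K) n (N ε) I) :=
    DefMap.isSeq (by fun_prop) (by fun_prop) (by fun_prop)
  exact h.comp hf

@[fun_prop]
theorem DefMap.isMonMul {f g h : Z → Rel₂ ε} (hf : DefMap (ε := ε) f) (hg : DefMap (ε := ε) g)
    (hh : DefMap (ε := ε) h) : DefMap (ε := ε) (fun z => IsMonMul (f z) (g z) (h z)) := by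
  have : DefMap (ε := ε) (fun q : (Rel₂ ε × Rel₂ ε) × Rel₂ ε => IsMonMul q.1.1 q.1.2 q.2) := by
    simp only [IsMonMul, imp_iff_not_or, all_iff]
    fun_prop
  exact this.comp ((hf.prodMk hg).prodMk hh)

section
omit hK

variable {n : K} {I J L : Rel₂ ε}

theorem expo_mem_N (hI : I ∈ Mon ε n) {i : K} (hi : i ∈ Seg ε n) : expo I i ∈ N ε :=
  IsSeq.entry_mem_set (X := K) hI hi

theorem mon_ext (hI : I ∈ Mon ε n) (hJ : J ∈ Mon ε n) (h : ∀ i ∈ Seg ε n, expo I i = expo J i) :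
    I = J :=
  IsSeq.ext (X := K) hI hJ h

theorem isMonMul_iff (hI : I ∈ Mon ε n) (hJ : J ∈ Mon ε n) (hL : L ∈ Mon ε n) :
    IsMonMul I J L ↔ ∀ i ∈ Seg ε n, expo L i = expo I i + expo J i := by
  constructor
  · intro h i hi
    exact IsSeq.entry_eq (X := K) hL
      (h i _ _ (IsSeq.entry_mem (X := K) hI hi) (IsSeq.entry_mem (X := K) hJ hi))
  · intro h i a b ha hb
    have hi := (hI.1 _ ha).1
    have h1 : expo I i = a := IsSeq.entry_eq (X := K) hI ha
    have h2 : expo J i = b := IsSeq.entry_eq (X := K) hJ hb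
    rw [← h1, ← h2, ← h i hi]
    exact IsSeq.entry_mem (X := K) hL hi

theorem IsMonMul.right_unique (hI : I ∈ Mon ε n) (hJ : J ∈ Mon ε n) (hL : L ∈ Mon ε n)
    {L' : Rel₂ ε} (hL' : L' ∈ Mon ε n) (h : IsMonMul I J L) (h' : IsMonMul I J L') : L = L' := by
  rw [isMonMul_iff hI hJ hL] at h
  rw [isMonMul_iff hI hJ hL'] at h'
  exact mon_ext hL hL' fun i hi => by rw [h i hi, h' i hi]

theorem IsMonMul.left_cancel (hI : I ∈ Mon ε n) (hJ : J ∈ Mon ε n) (hL : L ∈ Mon ε n)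
    {J' : Rel₂ ε} (hJ' : J' ∈ Mon ε n) (h : IsMonMul I J L) (h' : IsMonMul I J' L) : J = J' := by
  rw [isMonMul_iff hI hJ hL] at h
  rw [isMonMul_iff hI hJ' hL] at h'
  exact mon_ext hJ hJ' fun i hi => add_left_cancel ((h i hi).symm.trans (h' i hi))

end

theorem exists_mon {n : K} {φ : K → K} (hφ : DefMap (ε := ε) φ) (h : ∀ i ∈ Seg ε n, φ i ∈ N ε) :
    ∃ I ∈ Mon ε n, ∀ i ∈ Seg ε n, expo I i = φ i :=
  exists_isSeq (X := K) 0 hφ h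

/-- If the monomial `M` divides `L` coordinatewise, there is a quotient. -/
theorem exists_isMonMul_left {n : K} {M L : Rel₂ ε} (hM : M ∈ Mon ε n) (hL : L ∈ Mon ε n)
    (h : ∀ i ∈ Seg ε n, expo L i - expo M i ∈ N ε) : ∃ T ∈ Mon ε n, IsMonMul T M L := by
  obtain ⟨T, hT, hT'⟩ := exists_mon (ε := ε) (φ := fun i => expo L i - expo M i) (by fun_prop) h
  exact ⟨T, hT, (isMonMul_iff hT hM hL).2 fun i hi => by rw [hT' i hi]; ring⟩

/-- The lexicographic order on monomials in `n` variables. -/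
abbrev MonLT (n : K) (I J : Rel₂ ε) : Prop := LexLT ε n (expo I) (expo J)

@[fun_prop]
theorem DefMap.monLT {n : K} {f g : Z → Rel₂ ε} (hf : DefMap (ε := ε) f)
    (hg : DefMap (ε := ε) g) : DefMap (ε := ε) (fun z => MonLT n (f z) (g z)) := by
  simp only [MonLT, LexLT, imp_iff_not_or, all_iff]
  fun_prop

theorem MonLT.trans {n : K} {I J L : Rel₂ ε} (h : MonLT n I J) (h' : MonLT n J L) :
    MonLT n I L := by
  obtain ⟨i, hi, hlt, heq⟩ := h
  obtain ⟨j, hj, hlt', heq'⟩ := h'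
  rcases hK.out.lt_trichotomy hi.1 hj.1 with hij | rfl | hij
  · exact ⟨i, hi, by rwa [← heq' i hij], fun k hk =>
      (heq k hk).trans (heq' k (hK.out.lt_trans hk hij))⟩
  · exact ⟨i, hi, hK.out.lt_trans hlt hlt', fun k hk => (heq k hk).trans (heq' k hk)⟩
  · exact ⟨j, hj, by rwa [heq j hij], fun k hk =>
      (heq k (hK.out.lt_trans hk hij)).trans (heq' k hk)⟩

theorem MonLT.trichotomy {n : K} {I J : Rel₂ ε} (hI : I ∈ Mon ε n) (hJ : J ∈ Mon ε n) :
    MonLT n I J ∨ I = J ∨ MonLT n J I := by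
  by_cases h : ∃ i ∈ N ε, i ∈ Seg ε n ∧ expo I i ≠ expo J i
  · obtain ⟨i, -, ⟨hi, hne⟩, hmin⟩ := hK.out.exists_least
      (U := fun i => i ∈ Seg ε n ∧ expo I i ≠ expo J i)
      (by simp only [ne_eq]; fun_prop) h
    have heq : ∀ j ∈ Seg ε i, expo I j = expo J j := by
      intro j hj
      by_contra h'
      exact hmin j hj ⟨hK.out.lt_trans hj hi, h'⟩
    rcases hK.out.lt_trichotomy (expo_mem_N hI hi) (expo_mem_N hJ hi) with h' | h' | h'
    · exact Or.inl ⟨i, hi, h', heq⟩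
    · exact absurd h' hne
    · exact Or.inr (Or.inr ⟨i, hi, h', fun j hj => (heq j hj).symm⟩)
  · right; left
    refine mon_ext hI hJ fun i hi => ?_
    by_contra h'
    exact h ⟨i, hi.1, hi, h'⟩

theorem MonLT.mul_left {n : K} {T M M' L L' : Rel₂ ε} (hT : T ∈ Mon ε n) (hM : M ∈ Mon ε n)
    (hM' : M' ∈ Mon ε n) (hL : L ∈ Mon ε n) (hL' : L' ∈ Mon ε n) (h : MonLT n M M')
    (hML : IsMonMul T M L) (hML' : IsMonMul T M' L') : MonLT n L L' := by
  rw [isMonMul_iff hT hM hL] at hML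
  rw [isMonMul_iff hT hM' hL'] at hML'
  obtain ⟨i, hi, hlt, heq⟩ := h
  refine ⟨i, hi, ?_, fun j hj => ?_⟩
  · rw [hML i hi, hML' i hi]
    exact hK.out.add_mem_Seg hlt (expo_mem_N hT hi)
  · have hj' := hK.out.lt_trans hj hi
    rw [hML j hj', hML' j hj', heq j hj]

/-- A nonempty hyperfinite set of monomials has a greatest element. -/
theorem exists_max_mon {n : K} (A : Hyp (ch ε (Rel₂ ε))) (hA : ∀ I ∈ A.1, I ∈ Mon ε n)
    (hne : ∃ I, I ∈ A.1) : ∃ L ∈ A.1, ∀ M ∈ A.1, M = L ∨ MonLT n M L := by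
  revert hA hne
  refine hyp_ind (ε := ε) (X := Rel₂ ε) (U := fun A => (∀ I ∈ A.1, I ∈ Mon ε n) → (∃ I, I ∈ A.1) →
    ∃ L ∈ A.1, ∀ M ∈ A.1, M = L ∨ MonLT n M L) ?_ ?_ ?_ A
  · simp only [imp_iff_not_or, all_iff]
    fun_prop
  · rintro O hO - ⟨I, hI⟩
    exact absurd hI (hO I)
  · rintro a B C ih hC hCM -
    have haM := hCM a ((hC a).2 (Or.inr rfl))
    by_cases hB : ∃ I, I ∈ B.1
    · obtain ⟨L, hL, hmax⟩ := ih (fun I hI => hCM I ((hC I).2 (Or.inl hI))) hB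
      have hLM := hCM L ((hC L).2 (Or.inl hL))
      rcases MonLT.trichotomy haM hLM with h | rfl | h
      · refine ⟨L, (hC L).2 (Or.inl hL), fun M hM => ?_⟩
        rcases (hC M).1 hM with hM | rfl
        · exact hmax M hM
        · exact Or.inr h
      · refine ⟨a, (hC a).2 (Or.inr rfl), fun M hM => ?_⟩
        rcases (hC M).1 hM with hM | rfl
        · exact hmax M hM
        · exact Or.inl rfl
      · refine ⟨a, (hC a).2 (Or.inr rfl), fun M hM => ?_⟩
        rcases (hC M).1 hM with hM | rfl
        · rcases hmax M hM with rfl | h'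
          · exact Or.inr h
          · exact Or.inr (h'.trans h)
        · exact Or.inl rfl
    · refine ⟨a, (hC a).2 (Or.inr rfl), fun M hM => ?_⟩
      rcases (hC M).1 hM with hM | rfl
      · exact absurd ⟨M, hM⟩ hB
      · exact Or.inl rfl

/-! ### Polynomials -/

/-- A definable version of `coeff`, which agrees with it on polynomials. (Elsewhere `coeff` depends
on arbitrary choices.) -/
noncomputable def cf (p : Pre ε) (I : Rel₂ ε) : K := the 0 fun a => (I, a) ∈ p.1

@[fun_prop]
theorem DefMap.cf {f : Z → Pre ε} {g : Z → Rel₂ ε} (hf : DefMap (ε := ε) f)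
    (hg : DefMap (ε := ε) g) : DefMap (ε := ε) (fun z => cf (f z) (g z)) := by
  have h : DefMap (ε := ε) (fun q : (Pre ε × Rel₂ ε) × K => (q.1.2, q.2) ∈ q.1.1.1) :=
    DefMap.mem_hyp (X := Rel₂ ε × K) (by fun_prop) (by fun_prop)
  have h' : DefMap (ε := ε) (fun q : Pre ε × Rel₂ ε => HyperPoly.cf q.1 q.2) := DefMap.the h
  exact h'.comp (hf.prodMk hg)

theorem defMap_mem_Poly {R : Subfield K} (hR : DefMap (ε := ε) (fun x : K => x ∈ R)) (n : K) :
    DefMap (ε := ε) (fun p : Pre ε => p ∈ Poly ε R n) := by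
  have hm : DefMap (ε := ε) (fun q : Pre ε × (Rel₂ ε × K) => q.2 ∈ q.1.1) :=
    DefMap.mem_hyp (X := Rel₂ ε × K) (by fun_prop) (by fun_prop)
  have hm' : DefMap (ε := ε) (fun q : ((Pre ε × Rel₂ ε) × K) × K => (q.1.1.2, q.1.2) ∈ q.1.1.1.1) :=
    hm.comp (f := fun q : ((Pre ε × Rel₂ ε) × K) × K => (q.1.1.1, (q.1.1.2, q.1.2)))
      (by fun_prop)
  have hm'' : DefMap (ε := ε) (fun q : ((Pre ε × Rel₂ ε) × K) × K => (q.1.1.2, q.2) ∈ q.1.1.1.1) :=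
    hm.comp (f := fun q : ((Pre ε × Rel₂ ε) × K) × K => (q.1.1.1, (q.1.1.2, q.2)))
      (by fun_prop)
  simp only [Poly, Set.mem_ofPred_eq, imp_iff_not_or, all_iff, ne_eq]
  fun_prop

omit hK in
/-- A definable version of `IsTermMul`, which agrees with it on polynomials. -/
def TermMul (n : K) (a : K) (I : Rel₂ ε) (q r : Pre ε) : Prop :=
  (∀ J ∈ Mon ε n, ∀ L ∈ Mon ε n, IsMonMul I J L → cf r L = a * cf q J) ∧
  ∀ L ∈ Mon ε n, (∀ J ∈ Mon ε n, ¬ IsMonMul I J L) → cf r L = 0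

section
omit hK

variable {R : Subfield K} {n : K} {p q r : Pre ε} {I : Rel₂ ε} {a : K}

theorem cf_eq_of_mem (hp : p ∈ Poly ε R n) (h : (I, a) ∈ p.1) : cf p I = a :=
  the_eq h fun _ hb => hp.2 _ _ _ hb h

theorem cf_eq_zero (h : ¬ ∃ a, (I, a) ∈ p.1) : cf p I = 0 := the_eq_default h

theorem mem_iff_cf (hp : p ∈ Poly ε R n) : (I, a) ∈ p.1 ↔ a ≠ 0 ∧ cf p I = a := by
  constructor
  · exact fun h => ⟨(hp.1 _ h).2.2, cf_eq_of_mem hp h⟩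
  · rintro ⟨ha, rfl⟩
    by_contra h
    apply ha
    apply cf_eq_zero
    rintro ⟨b, hb⟩
    rw [cf_eq_of_mem hp hb] at h
    exact h hb

theorem coeff_eq_cf (hp : p ∈ Poly ε R n) : coeff p I = cf p I := by
  by_cases h : ∃ a, (I, a) ∈ p.1
  · rw [coeff, dif_pos h, cf_eq_of_mem hp h.choose_spec]
  · rw [coeff, dif_neg h, cf_eq_zero h]

theorem mem_supp_iff (hp : p ∈ Poly ε R n) : I ∈ supp p ↔ cf p I ≠ 0 := by
  constructor
  · rintro ⟨a, ha⟩
    rw [cf_eq_of_mem hp ha]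
    exact (hp.1 _ ha).2.2
  · exact fun h => ⟨cf p I, (mem_iff_cf hp).2 ⟨h, rfl⟩⟩

theorem mem_Mon_of_cf (hp : p ∈ Poly ε R n) (h : cf p I ≠ 0) : I ∈ Mon ε n := by
  obtain ⟨a, ha⟩ := (mem_supp_iff hp).2 h
  exact (hp.1 _ ha).1

theorem cf_mem (hp : p ∈ Poly ε R n) (I : Rel₂ ε) : cf p I ∈ R := by
  by_cases h : cf p I = 0
  · rw [h]
    exact R.zero_mem
  · obtain ⟨a, ha⟩ := (mem_supp_iff hp).2 h
    rw [cf_eq_of_mem hp ha]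
    exact (hp.1 _ ha).2.1

theorem isZero_iff (hp : p ∈ Poly ε R n) : IsZero p ↔ ∀ I, cf p I = 0 := by
  constructor
  · intro h I
    apply cf_eq_zero
    rintro ⟨a, ha⟩
    rw [h] at ha
    exact ha
  · intro h
    refine Set.eq_empty_of_forall_notMem ?_
    rintro ⟨I, a⟩ ha
    exact (mem_supp_iff hp).1 ⟨a, ha⟩ (h I)

theorem isAdd_iff (hp : p ∈ Poly ε R n) (hq : q ∈ Poly ε R n) (hr : r ∈ Poly ε R n) :
    IsAdd p q r ↔ ∀ I, cf r I = cf p I + cf q I := by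
  simp only [IsAdd, coeff_eq_cf hp, coeff_eq_cf hq, coeff_eq_cf hr]

theorem isTermMul_iff {J : Rel₂ ε} (hq : q ∈ Poly ε R n) (hr : r ∈ Poly ε R n) :
    IsTermMul n a J q r ↔ TermMul n a J q r := by
  simp only [IsTermMul, TermMul, coeff_eq_cf hq, coeff_eq_cf hr]

end

theorem hyperfinite_cf_ne_zero {R : Subfield K} {n : K} {p : Pre ε} (hp : p ∈ Poly ε R n) :
    Hyperfinite ε (fun I => cf p I ≠ 0) := by
  have h : Hyperfinite ε (fun q : Rel₂ ε × K => q ∈ p.1) := ⟨p, fun _ => Iff.rfl⟩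
  refine (h.image (f := fun q => q.1) (by fun_prop)).congr fun I => ?_
  rw [← mem_supp_iff hp]
  constructor
  · rintro ⟨⟨J, a⟩, h, rfl⟩
    exact ⟨a, h⟩
  · rintro ⟨a, h⟩
    exact ⟨(I, a), h, rfl⟩

/-- A definable function of monomials whose support lies in a hyperfinite set is the coefficient
function of a polynomial. -/
theorem exists_poly {R : Subfield K} {n : K} {g : Rel₂ ε → K} (hg : DefMap (ε := ε) g)
    (hR : ∀ I, g I ∈ R) {A : Rel₂ ε → Prop} (hA : Hyperfinite ε A)
    (h : ∀ I, g I ≠ 0 → A I ∧ I ∈ Mon ε n) : ∃ p ∈ Poly ε R n, ∀ I, cf p I = g I := by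
  have h1 : Hyperfinite ε (fun I => A I ∧ g I ≠ 0) :=
    hA.sep (by simp only [ne_eq]; fun_prop)
  obtain ⟨p, hp⟩ := h1.image (f := fun I => (I, g I)) (by fun_prop)
  have hmem : ∀ I a, (I, a) ∈ p.1 ↔ g I ≠ 0 ∧ a = g I := by
    intro I a
    refine (hp _).trans ?_
    constructor
    · rintro ⟨J, ⟨-, hJ⟩, hJ'⟩
      obtain ⟨rfl, rfl⟩ := Prod.mk.inj hJ'
      exact ⟨hJ, rfl⟩
    · rintro ⟨hI, rfl⟩
      exact ⟨I, ⟨(h I hI).1, hI⟩, rfl⟩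
  have hpP : p ∈ Poly ε R n := by
    constructor
    · rintro ⟨I, a⟩ hq
      obtain ⟨hI, rfl⟩ := (hmem I a).1 hq
      exact ⟨(h I hI).2, hR I, hI⟩
    · intro I a b ha hb
      rw [((hmem I a).1 ha).2, ((hmem I b).1 hb).2]
  refine ⟨p, hpP, fun I => ?_⟩
  by_cases hI : g I = 0
  · rw [hI]
    apply cf_eq_zero
    rintro ⟨a, ha⟩
    exact ((hmem I a).1 ha).1 hI
  · exact cf_eq_of_mem hpP ((hmem _ _).2 ⟨hI, rfl⟩)

theorem exists_zero (R : Subfield K) (n : K) : ∃ z ∈ Poly ε R n, ∀ I, cf z I = 0 :=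
  exists_poly (DefMap.const 0) (fun _ => R.zero_mem) hyperfinite_empty
    (fun _ h => absurd rfl h)

theorem exists_add {R : Subfield K} {n : K} {p q : Pre ε} (hp : p ∈ Poly ε R n)
    (hq : q ∈ Poly ε R n) : ∃ r ∈ Poly ε R n, ∀ I, cf r I = cf p I + cf q I := by
  refine exists_poly (by fun_prop) (fun I => R.add_mem (cf_mem hp I) (cf_mem hq I))
    ((hyperfinite_cf_ne_zero hp).union (hyperfinite_cf_ne_zero hq)) (fun I h => ?_)
  by_cases h1 : cf p I = 0
  · have h2 : cf q I ≠ 0 := fun h2 => h (by rw [h1, h2, add_zero])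
    exact ⟨Or.inr h2, mem_Mon_of_cf hq h2⟩
  · exact ⟨Or.inl h1, mem_Mon_of_cf hp h1⟩

/-- The polynomial `a x^T`. -/
theorem exists_term {R : Subfield K} {n a : K} (ha : a ∈ R) (ha0 : a ≠ 0) {T : Rel₂ ε}
    (hT : T ∈ Mon ε n) :
    ∃ p ∈ Poly ε R n, ∀ q, q ∈ p.1 ↔ q = (T, a) := by
  obtain ⟨p, hp⟩ := hyperfinite_singleton (ε := ε) (T, a)
  refine ⟨p, ⟨fun q hq => ?_, fun I b c hb hc => ?_⟩, hp⟩
  · rw [(hp q).1 hq]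
    exact ⟨hT, ha, ha0⟩
  · have h1 := (hp _).1 hb
    have h2 := (hp _).1 hc
    exact (Prod.mk.inj (h1.trans h2.symm)).2

/-- The polynomial `a x^T q`. -/
theorem exists_termMul {R : Subfield K} {n a : K} (ha : a ∈ R) {T : Rel₂ ε} (hT : T ∈ Mon ε n)
    {q : Pre ε} (hq : q ∈ Poly ε R n) : ∃ r ∈ Poly ε R n, IsTermMul n a T q r := by
  classical
  have hA : Hyperfinite ε (fun L => ∃ M, cf q M ≠ 0 ∧ (L ∈ Mon ε n ∧ IsMonMul T M L)) := by
    refine (hyperfinite_cf_ne_zero hq).biUnion (by fun_prop) fun M hM => ?_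
    by_cases h : ∃ L ∈ Mon ε n, IsMonMul T M L
    · obtain ⟨L, hL, hML⟩ := h
      refine (hyperfinite_singleton L).congr fun L' => ?_
      constructor
      · rintro rfl
        exact ⟨hL, hML⟩
      · rintro ⟨hL', hML'⟩
        exact IsMonMul.right_unique hT (mem_Mon_of_cf hq hM) hL' hL hML' hML
    · exact hyperfinite_empty.congr fun L => iff_of_false id fun h' => h ⟨L, h'⟩
  -- the coefficient function of `a x^T q`; the default `T` of `the` is never used
  set g : Rel₂ ε → K := fun L => if L ∈ Mon ε n ∧ ∃ M ∈ Mon ε n, IsMonMul T M L then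
    a * cf q (the T fun M => M ∈ Mon ε n ∧ IsMonMul T M L) else 0 with hg
  have hgd : DefMap (ε := ε) g := by fun_prop
  have hgval : ∀ M ∈ Mon ε n, ∀ L ∈ Mon ε n, IsMonMul T M L → g L = a * cf q M := by
    intro M hM L hL hML
    rw [hg]
    simp only
    rw [if_pos ⟨hL, M, hM, hML⟩, the_eq (x := M) ⟨hM, hML⟩ fun M' h' =>
      IsMonMul.left_cancel hT h'.1 hL hM h'.2 hML]
  have hgzero : ∀ L, ¬ (L ∈ Mon ε n ∧ ∃ M ∈ Mon ε n, IsMonMul T M L) → g L = 0 :=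
    fun L hL => if_neg hL
  obtain ⟨r, hr, hrg⟩ := exists_poly (R := R) (n := n) hgd (by
    intro L
    by_cases hL : L ∈ Mon ε n ∧ ∃ M ∈ Mon ε n, IsMonMul T M L
    · obtain ⟨hL, M, hM, hML⟩ := hL
      rw [hgval M hM L hL hML]
      exact R.mul_mem ha (cf_mem hq M)
    · rw [hgzero L hL]
      exact R.zero_mem) hA (by
    intro L h
    by_cases hL : L ∈ Mon ε n ∧ ∃ M ∈ Mon ε n, IsMonMul T M L
    · obtain ⟨hL, M, hM, hML⟩ := hL
      rw [hgval M hM L hL hML] at h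
      exact ⟨⟨M, right_ne_zero_of_mul h, hL, hML⟩, hL⟩
    · exact absurd (hgzero L hL) h)
  refine ⟨r, hr, (isTermMul_iff hq hr).2 ⟨fun M hM L hL hML => ?_, fun L hL h => ?_⟩⟩
  · rw [hrg, hgval M hM L hL hML]
  · rw [hrg, hgzero L]
    rintro ⟨-, M, hM, hML⟩
    exact h M hM hML

/-- `L` is the leading monomial of `p`. -/
def IsLead (n : K) (p : Pre ε) (L : Rel₂ ε) : Prop :=
  cf p L ≠ 0 ∧ ∀ M, cf p M ≠ 0 → M = L ∨ MonLT n M L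

theorem exists_isLead {R : Subfield K} {n : K} {p : Pre ε} (hp : p ∈ Poly ε R n)
    (h0 : ∃ I, cf p I ≠ 0) : ∃ L, IsLead n p L := by
  obtain ⟨A, hA⟩ := hyperfinite_cf_ne_zero hp
  obtain ⟨L, hL, hmax⟩ := exists_max_mon A (n := n)
    (fun I hI => mem_Mon_of_cf hp ((hA I).1 hI)) (by simpa only [hA] using h0)
  exact ⟨L, (hA L).1 hL, fun M hM => hmax M ((hA M).2 hM)⟩

omit hK in
theorem MonLT.irrefl {n : K} {I : Rel₂ ε} : ¬ MonLT n I I := by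
  rintro ⟨i, -, h, -⟩
  exact notMem_Seg_self h

theorem IsLead.unique {n : K} {p : Pre ε} {L L' : Rel₂ ε} (h : IsLead n p L)
    (h' : IsLead n p L') : L = L' := by
  rcases h'.2 L h.1 with rfl | h1
  · rfl
  · rcases h.2 L' h'.1 with rfl | h2
    · rfl
    · exact absurd (h1.trans h2) MonLT.irrefl

/-- The exponents of the leading monomial of `p`. -/
noncomputable def leadExpo (n : K) (p : Pre ε) (i : K) : K :=
  the 0 fun a => ∃ L, IsLead n p L ∧ expo L i = a

theorem defMap_leadExpo (n : K) :
    DefMap (ε := ε) (fun q : Pre ε × K => leadExpo n q.1 q.2) := by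
  simp only [leadExpo, IsLead, ne_eq, imp_iff_not_or, all_iff]
  fun_prop

theorem IsLead.leadExpo_eq {n : K} {p : Pre ε} {L : Rel₂ ε} (h : IsLead n p L) :
    leadExpo n p = expo L := by
  funext i
  refine the_eq ⟨L, h, rfl⟩ ?_
  rintro _ ⟨L', h', rfl⟩
  rw [h'.unique h]

end

section

variable {K : Type u} {F : Type v} [Field K] {ε : K → F → Prop} [hK : Fact (DefCharZero ε)]
variable {R : Subfield K} {n : K}

/-! ### Multiplication by terms -/

omit hK in
theorem TermMul.neg {c : K} {T : Rel₂ ε} {g t t' : Pre ε} (ht : t ∈ Poly ε R n)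
    (ht' : t' ∈ Poly ε R n) (h : TermMul n c T g t) (h' : TermMul n (-c) T g t') (L : Rel₂ ε) :
    cf t' L = - cf t L := by
  by_cases hL : L ∈ Mon ε n
  · by_cases hM : ∃ M ∈ Mon ε n, IsMonMul T M L
    · obtain ⟨M, hM, hML⟩ := hM
      rw [h.1 M hM L hL hML, h'.1 M hM L hL hML]
      ring
    · have hM' : ∀ M ∈ Mon ε n, ¬ IsMonMul T M L := fun M h1 h2 => hM ⟨M, h1, h2⟩
      rw [h.2 L hL hM', h'.2 L hL hM', neg_zero]
  · have h1 : cf t L = 0 := by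
      by_contra h0
      exact hL (mem_Mon_of_cf ht h0)
    have h2 : cf t' L = 0 := by
      by_contra h0
      exact hL (mem_Mon_of_cf ht' h0)
    rw [h1, h2, neg_zero]

/-- `a` is a term `c x^T` with `c ∈ R` nonzero, and `t = a g`. -/
def TermStep (R : Subfield K) (n : K) (g a t : Pre ε) : Prop :=
  ∃ T ∈ Mon ε n, ∃ c ∈ R, c ≠ 0 ∧ (∀ q, q ∈ a.1 ↔ q = (T, c)) ∧ TermMul n c T g t

/-- The product of the term `c x^T` with `g`, restricted to a set `A` of monomials, is `t` if
`T ∈ A`, and `0` otherwise. -/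
theorem TermStep.isMul {g a t : Pre ε} (h : TermStep R n g a t) (hg : g ∈ Poly ε R n)
    (ha : a ∈ Poly ε R n) (ht : t ∈ Poly ε R n) : IsMul R n a g t := by
  classical
  obtain ⟨T, hT, c, hc, hc0, hac, hgt⟩ := h
  obtain ⟨z, hz, hz0⟩ := exists_zero (ε := ε) R n
  have hm : DefMap (ε := ε) (fun A : Hyp (ch ε (Rel₂ ε)) => T ∈ A.1) :=
    DefMap.mem_hyp (by fun_prop) (by fun_prop)
  have hG : ∀ A : Hyp (chartRel₂ ε), (if T ∈ A.1 then t else z) ∈ Poly ε R n := by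
    intro A
    split_ifs
    · exact ht
    · exact hz
  refine ⟨fun A => if T ∈ A.1 then t else z, ?_, fun A _ => hG A, ?_, ?_, ?_⟩
  · have hsub : DefMap (ε := ε) (fun A : Hyp (ch ε (Rel₂ ε)) => A.1 ⊆ Mon ε n) := by
      have hm' : DefMap (ε := ε) (fun q : Hyp (ch ε (Rel₂ ε)) × Rel₂ ε => q.2 ∈ q.1.1) :=
        DefMap.mem_hyp (by fun_prop) (by fun_prop)
      simp only [Set.subset_def, imp_iff_not_or, all_iff]
      fun_prop
    have hite : DefMap (ε := ε) (fun A : Hyp (ch ε (Rel₂ ε)) => if T ∈ A.1 then t else z) :=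
      DefMap.ite hm (DefMap.const t) (DefMap.const z)
    have : DefMap (ε := ε) (fun s : Hyp (ch ε (Rel₂ ε)) × Pre ε =>
        s.1.1 ⊆ Mon ε n ∧ (if T ∈ s.1.1 then t else z) = s.2) :=
      (hsub.comp defMap_fst).and (DefMap.eq (hite.comp defMap_fst) defMap_snd)
    exact this.defSet
  · intro A hA
    simp only [hA, Set.mem_empty_iff_false, if_false]
    exact (isZero_iff hz).2 hz0
  · intro A B I hI hB hIB hA
    have hcf : ∀ I, cf a I = if I = T then c else 0 := by
      intro I
      split_ifs with h
      · rw [h]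
        exact cf_eq_of_mem ha ((hac _).2 rfl)
      · apply cf_eq_zero
        rintro ⟨b, hb⟩
        exact h (Prod.mk.inj ((hac _).1 hb)).1
    rw [coeff_eq_cf ha, hcf]
    by_cases hIT : I = T
    · subst hIT
      refine ⟨t, ht, ?_, ?_⟩
      · rw [if_pos rfl]
        exact (isTermMul_iff hg ht).2 hgt
      · refine (isAdd_iff (hG B) ht (hG A)).2 fun L => ?_
        rw [if_neg hIB, if_pos (hA ▸ Set.mem_insert _ _), hz0, zero_add]
    · refine ⟨z, hz, ?_, ?_⟩
      · rw [if_neg hIT]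
        refine (isTermMul_iff hg hz).2 ⟨fun M _ L _ _ => ?_, fun L _ _ => hz0 L⟩
        rw [hz0, zero_mul]
      · refine (isAdd_iff (hG B) hz (hG A)).2 fun L => ?_
        have : T ∈ A.1 ↔ T ∈ B.1 := by
          rw [hA, Set.mem_insert_iff]
          exact or_iff_right (Ne.symm hIT)
        simp only [this, hz0, add_zero]
  · obtain ⟨A, hA⟩ := hyperfinite_singleton (ε := ε) T
    refine ⟨A, Set.ext fun I => (hA I).trans ?_, if_pos ((hA T).2 rfl)⟩
    constructor
    · rintro rfl
      exact ⟨c, (hac _).2 rfl⟩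
    · rintro ⟨b, hb⟩
      exact (Prod.mk.inj ((hac _).1 hb)).1

/-- Division step: an appropriate multiple of `g` cancels the leading term of `p`. -/
theorem exists_reduction {I : Set (Pre ε)} (hI : IsPolyIdeal R n I) {p g : Pre ε} (hp : p ∈ I)
    (hg : g ∈ I) {L M : Rel₂ ε} (hL : IsLead n p L) (hM : IsLead n g M)
    (hle : ∀ i ∈ Seg ε n, expo L i - expo M i ∈ N ε) :
    ∃ a ∈ Poly ε R n, ∃ t ∈ Poly ε R n, ∃ q ∈ I, TermStep R n g a t ∧
      (∀ S, cf p S = cf q S + cf t S) ∧ ∀ S, cf q S ≠ 0 → MonLT n S L := by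
  have hpP := hI.subset hp
  have hgP := hI.subset hg
  have hLn := mem_Mon_of_cf hpP hL.1
  have hMn := mem_Mon_of_cf hgP hM.1
  obtain ⟨T, hT, hTML⟩ := exists_isMonMul_left hMn hLn hle
  set c := cf p L / cf g M with hc
  have hcR : c ∈ R := R.div_mem (cf_mem hpP L) (cf_mem hgP M)
  have hc0 : c ≠ 0 := div_ne_zero hL.1 hM.1
  obtain ⟨a, haP, ha⟩ := exists_term (ε := ε) (n := n) hcR hc0 hT
  obtain ⟨a', haP', ha'⟩ := exists_term (ε := ε) (n := n) (R.neg_mem hcR) (neg_ne_zero.2 hc0) hT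
  obtain ⟨t, htP, ht⟩ := exists_termMul hcR hT hgP
  obtain ⟨t', htP', ht'⟩ := exists_termMul (R.neg_mem hcR) hT hgP
  rw [isTermMul_iff hgP htP] at ht
  rw [isTermMul_iff hgP htP'] at ht'
  have hneg := ht.neg htP htP' ht'
  have htI : t' ∈ I := by
    refine hI.mul_mem a' haP' g hg t' htP' (TermStep.isMul ?_ hgP haP' htP')
    exact ⟨T, hT, -c, R.neg_mem hcR, neg_ne_zero.2 hc0, ha', ht'⟩
  obtain ⟨q, hqP, hq⟩ := exists_add hpP htP'
  refine ⟨a, haP, t, htP, q, hI.add_mem p hp t' htI q hqP ((isAdd_iff hpP htP' hqP).2 hq),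
    ⟨T, hT, c, hcR, hc0, ha, ht⟩, fun S => by rw [hq, hneg]; ring, fun S hS => ?_⟩
  have hSL : S ≠ L := by
    rintro rfl
    apply hS
    rw [hq, hneg, ht.1 M hMn S hLn hTML, hc, div_mul_cancel₀ _ hM.1, add_neg_cancel]
  by_cases hpS : cf p S = 0
  · have htS : cf t' S ≠ 0 := fun h => hS (by rw [hq, hpS, h, add_zero])
    have hSn := mem_Mon_of_cf htP' htS
    by_cases hex : ∃ V ∈ Mon ε n, IsMonMul T V S
    · obtain ⟨V, hV, hTV⟩ := hex
      rw [ht'.1 V hV S hSn hTV] at htS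
      rcases hM.2 V (right_ne_zero_of_mul htS) with rfl | hlt
      · exact absurd (hTV.right_unique hT hV hSn hLn hTML) hSL
      · exact hlt.mul_left hT hV hMn hSn hLn hTV hTML
    · exact absurd (ht'.2 S hSn fun V h1 h2 => hex ⟨V, h1, h2⟩) htS
  · exact (hL.2 S hpS).resolve_left hSL

/-! ### Hyperfinite combinations -/

/-- `p = ∑_{i<m} a_i g_i` with terms `a_i` and `g_i ∈ J`. Here `t_i = a_i g_i`, and `f` is the
sequence of partial sums. In contrast to `Generates`, this quantifies over elements only, and not
over definable functions, so that it defines a definable set. The polynomial `d` is an arbitrary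
default value for entries of sequences. -/
def Generated (R : Subfield K) (n : K) (d : Pre ε) (J : Hyp (ch ε (Pre ε))) (p : Pre ε) : Prop :=
  ∃ m ∈ N ε, ∃ g a t f : Hyp (ch ε (K × Pre ε)),
    IsSeq (c := ch ε (Pre ε)) m J.1 g ∧ IsSeq (c := ch ε (Pre ε)) m (Poly ε R n) a ∧
    IsSeq (c := ch ε (Pre ε)) m (Poly ε R n) t ∧
    IsSeq (c := ch ε (Pre ε)) (m + 1) (Poly ε R n) f ∧
    (∀ I, cf (entry d f 0) I = 0) ∧ entry d f m = p ∧
    ∀ i ∈ Seg ε m, TermStep R n (entry d g i) (entry d a i) (entry d t i) ∧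
      ∀ I, cf (entry d f (i + 1)) I = cf (entry d f i) I + cf (entry d t i) I

theorem defMap_generated (hR : DefMap (ε := ε) (fun x : K => x ∈ R)) (d : Pre ε)
    (J : Hyp (ch ε (Pre ε))) : DefMap (ε := ε) (Generated R n d J) := by
  have hP := defMap_mem_Poly hR n
  have hJ : DefMap (ε := ε) (fun p => p ∈ J.1) := DefMap.mem_hyp (by fun_prop) (by fun_prop)
  have hm : DefMap (ε := ε) (fun q : (Rel₂ ε × K) × Pre ε => q.1 ∈ q.2.1) :=
    DefMap.mem_hyp (by fun_prop) (by fun_prop)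
  have hT : DefMap (ε := ε) (fun q : Pre ε × Pre ε × Pre ε => TermStep R n q.1 q.2.1 q.2.2) := by
    have hm' : DefMap (ε := ε) (fun q : (((Pre ε × Pre ε × Pre ε) × Rel₂ ε) × K) × (Rel₂ ε × K) =>
        q.2 ∈ q.1.1.1.2.1.1) :=
      hm.comp (f := fun q : (((Pre ε × Pre ε × Pre ε) × Rel₂ ε) × K) × (Rel₂ ε × K) =>
        (q.2, q.1.1.1.2.1)) (by fun_prop)
    simp only [TermStep, TermMul, imp_iff_not_or, all_iff, ne_eq]
    fun_prop
  have hT' : DefMap (ε := ε) (fun q : (Hyp (ch ε (K × Pre ε)) × Hyp (ch ε (K × Pre ε)) ×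
      Hyp (ch ε (K × Pre ε))) × K =>
      TermStep R n (entry d q.1.1 q.2) (entry d q.1.2.1 q.2) (entry d q.1.2.2 q.2)) :=
    hT.comp (f := fun q : (Hyp (ch ε (K × Pre ε)) × Hyp (ch ε (K × Pre ε)) ×
      Hyp (ch ε (K × Pre ε))) × K =>
      (entry d q.1.1 q.2, entry d q.1.2.1 q.2, entry d q.1.2.2 q.2)) (by fun_prop)
  unfold Generated
  simp only [imp_iff_not_or, all_iff]
  fun_prop

theorem generated_zero {d : Pre ε} {J : Hyp (ch ε (Pre ε))} {p : Pre ε} (hp : p ∈ Poly ε R n)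
    (h0 : ∀ I, cf p I = 0) : Generated R n d J p := by
  have hc : DefMap (ε := ε) (fun _ : K => p) := by fun_prop
  have he : ∀ S : Set (Pre ε), ∃ f : Hyp (ch ε (K × Pre ε)), IsSeq (c := ch ε (Pre ε)) 0 S f := by
    intro S
    obtain ⟨f, hf, -⟩ := exists_isSeq (S := S) d (n := 0) hc
      fun i hi => absurd hi hK.out.notMem_Seg_zero
    exact ⟨f, hf⟩
  obtain ⟨g, hg⟩ := he J.1
  obtain ⟨t, ht⟩ := he (Poly ε R n)
  obtain ⟨f, hf, hfp⟩ := exists_isSeq (S := Poly ε R n) d (n := 0 + 1) hc fun _ _ => hp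
  have hf0 := hfp 0 (hK.out.self_mem_Seg_succ hK.out.zero_mem)
  exact ⟨0, hK.out.zero_mem, g, t, t, f, hg, ht, ht, hf, fun I => by rw [hf0, h0], hf0,
    fun i hi => absurd hi hK.out.notMem_Seg_zero⟩

theorem Generated.add_term {d : Pre ε} {J : Hyp (ch ε (Pre ε))} {p q g₀ a₀ t₀ : Pre ε}
    (hq : Generated R n d J q) (hp : p ∈ Poly ε R n) (hg₀ : g₀ ∈ J.1) (ha₀ : a₀ ∈ Poly ε R n)
    (ht₀ : t₀ ∈ Poly ε R n) (h : TermStep R n g₀ a₀ t₀)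
    (hpq : ∀ I, cf p I = cf q I + cf t₀ I) : Generated R n d J p := by
  obtain ⟨m, hm, g, a, t, f, hg, ha, ht, hf, hf0, hfm, hstep⟩ := hq
  have hm1 := hK.out.succ_mem hm
  obtain ⟨g', hg', h1, h1'⟩ := hg.exists_snoc d hm hg₀
  obtain ⟨a', ha', h2, h2'⟩ := ha.exists_snoc d hm ha₀
  obtain ⟨t', ht', h3, h3'⟩ := ht.exists_snoc d hm ht₀
  obtain ⟨f', hf', h4, h4'⟩ := hf.exists_snoc d hm1 hp
  have hlt : ∀ i, i ∈ Seg ε m → i ∈ Seg ε (m + 1) :=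
    fun i hi => (hK.out.mem_Seg_succ hm).2 (Or.inl hi)
  have hsucc : ∀ i, i ∈ Seg ε m → i + 1 ∈ Seg ε (m + 1) := by
    intro i hi
    rw [add_comm i, add_comm m]
    exact hK.out.add_mem_Seg hi hK.out.one_mem
  refine ⟨m + 1, hm1, g', a', t', f', hg', ha', ht', hf', ?_, h4', fun i hi => ?_⟩
  · rw [h4 0 ⟨hK.out.zero_mem, ?_, by simpa using hm1⟩]
    · exact hf0
    · intro h'
      exact hK.out.neg_one_notMem (by
        have : m = -1 := by linear_combination -h'
        rwa [← this])
  · rcases (hK.out.mem_Seg_succ hm).1 hi with hi | rfl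
    · rw [h1 i hi, h2 i hi, h3 i hi, h4 _ (hsucc i hi), h4 i (hlt i hi)]
      exact hstep i hi
    · rw [h1', h2', h3', h4', h4 i (hK.out.self_mem_Seg_succ hm), hfm]
      exact ⟨h, hpq⟩

/-- The first-order notion of a combination implies the one in the definition of `Generates`. -/
theorem Generated.exists_isSum {d : Pre ε} (hd : d ∈ Poly ε R n) {J : Hyp (ch ε (Pre ε))}
    (hJ : J.1 ⊆ Poly ε R n) {p : Pre ε} (hp : Generated R n d J p) :
    ∃ m ∈ N ε, ∃ g a t : Hyp ((chartK ε).prod (chartPre ε)),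
    IsSeq m J.1 g ∧ IsSeq m (Poly ε R n) a ∧ IsSeq m (Poly ε R n) t ∧
    (∀ i x y z, (i, x) ∈ a.1 → (i, y) ∈ g.1 → (i, z) ∈ t.1 → IsMul R n x y z) ∧
    IsSum R n m t p := by
  classical
  obtain ⟨m, hm, g, a, t, f, hg, ha, ht, hf, hf0, hfm, hstep⟩ := hp
  refine ⟨m, hm, g, a, t, hg, ha, ht, fun i x y z hx hy hz => ?_, ?_⟩
  · have hi := (hg.1 _ hy).1
    have h := (hstep i hi).1
    rw [hg.entry_eq hy, ha.entry_eq hx, ht.entry_eq hz] at h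
    exact h.isMul (hJ (hg.1 _ hy).2) (ha.1 _ hx).2 (ht.1 _ hz).2
  · have hval : ∀ i, i ∈ Seg ε (m + 1) → (if i ∈ Seg ε (m + 1) then entry d f i else d) =
        entry d f i := fun i hi => if_pos hi
    have hmem : ∀ i, (if i ∈ Seg ε (m + 1) then entry d f i else d) ∈ Poly ε R n := by
      intro i
      split_ifs with hi
      · exact hf.entry_mem_set hi
      · exact hd
    refine ⟨fun i => if i ∈ Seg ε (m + 1) then entry d f i else d, ?_, fun i _ => hmem i,
      ?_, ?_, ?_⟩
    · have : DefMap (ε := ε) (fun q : K × Pre ε => q.1 ∈ N ε ∧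
          (if q.1 ∈ Seg ε (m + 1) then entry d f q.1 else d) = q.2) := by fun_prop
      exact this.defSet
    · refine (isZero_iff (hmem 0)).2 fun I => ?_
      split_ifs
      · exact hf0 I
      · rename_i h
        refine absurd ⟨hK.out.zero_mem, ?_, ?_⟩ h
        · intro h'
          exact hK.out.neg_one_notMem (by
            have : m = -1 := by linear_combination -h'
            rwa [← this])
        · simpa using hK.out.succ_mem hm
    · intro i hi q hq
      refine (isAdd_iff (hmem i) (ht.1 _ hq).2 (hmem (i + 1))).2 fun I => ?_
      rw [hval i ((hK.out.mem_Seg_succ hm).2 (Or.inl hi)), hval (i + 1) (by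
        rw [add_comm i, add_comm m]
        exact hK.out.add_mem_Seg hi hK.out.one_mem), (hstep i hi).2, ht.entry_eq hq]
    · rw [← hfm]
      exact hval m (hK.out.self_mem_Seg_succ hm)

/-- A basis given by Dickson's lemma for the leading exponents generates the ideal. -/
theorem exists_generates (hR : DefSet ε (R : Set K)) (hn : n ∈ N ε) {I : Set (Pre ε)}
    (hI : IsPolyIdeal R n I) (hId : DefSet ε I) : ∃ J : Hyp (chartPre ε), Generates R n J.1 I := by
  have hRd : DefMap (ε := ε) (fun x : K => x ∈ R) := hR.defMap
  have hIm := hId.defMap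
  have hlead := defMap_leadExpo (ε := ε) n
  have hex : ∀ p ∈ I, (∃ V, cf p V ≠ 0) → ∃ L, IsLead n p L := fun p hp h0 =>
    exists_isLead (hI.subset hp) h0
  have hN : ∀ p, (p ∈ I ∧ ∃ V, cf p V ≠ 0) → ∀ i ∈ Seg ε n, leadExpo n p i ∈ N ε := by
    rintro p ⟨hp, h0⟩ i hi
    obtain ⟨L, hL⟩ := hex p hp h0
    rw [hL.leadExpo_eq]
    exact expo_mem_N (mem_Mon_of_cf (hI.subset hp) hL.1) hi
  obtain ⟨J, hJ, hJdom⟩ := dickson (ε := ε) (D := fun p : Pre ε => p ∈ I ∧ ∃ V, cf p V ≠ 0)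
    (by simp only [ne_eq]; fun_prop) hlead hn hN
  have hJI : J.1 ⊆ I := fun p hp => (hJ p hp).1
  obtain ⟨d, hd, -⟩ := exists_zero (ε := ε) R n
  have hgen := defMap_generated (n := n) hRd d J
  refine ⟨J, hJI, fun p hp => Generated.exists_isSum hd (hJI.trans hI.subset) ?_⟩
  by_contra hpG
  have hnz : ∀ p ∈ I, ¬ Generated R n d J p → ∃ V, cf p V ≠ 0 := by
    intro p hp hpG
    by_contra! h0
    exact hpG (generated_zero (hI.subset hp) h0)
  -- a counterexample whose leading monomial is minimal
  obtain ⟨p, ⟨hp, hpG⟩, hmin⟩ := exists_lex_minimal hK.out (ε := ε)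
    (D := fun p : Pre ε => p ∈ I ∧ ¬ Generated R n d J p) (by fun_prop) hlead hn
    (fun p hp => hN p ⟨hp.1, hnz p hp.1 hp.2⟩) ⟨p, hp, hpG⟩
  have hp0 := hnz p hp hpG
  obtain ⟨L, hL⟩ := hex p hp hp0
  obtain ⟨g, hg, hgp⟩ := hJdom p ⟨hp, hp0⟩
  obtain ⟨M, hM⟩ := hex g (hJI hg) (hJ g hg).2
  rw [hL.leadExpo_eq, hM.leadExpo_eq] at hgp
  obtain ⟨a, ha, t, ht, q, hq, hstep, hpq, hlt⟩ := exists_reduction hI hp (hJI hg) hL hM hgp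
  refine hpG (Generated.add_term ?_ (hI.subset hp) hg ha ht hstep hpq)
  by_contra hqG
  obtain ⟨L', hL'⟩ := hex q hq (hnz q hq hqG)
  refine hmin q ⟨hq, hqG⟩ ?_
  rw [hL.leadExpo_eq, hL'.leadExpo_eq]
  exact hlt L' hL'.1

end

end HyperPoly

theorem mainTheorem10 {K F : Type*} [Field K] (ε : K → F → Prop)
    (hK : HyperPoly.DefCharZero ε)
    (R : Subfield K) (hR : (HyperPoly.chartK ε).DefinableSet (R : Set K))
    (n : K) (hn : n ∈ HyperPoly.N ε)
    (I : Set (HyperPoly.Pre ε)) (hI : HyperPoly.IsPolyIdeal R n I)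
    (hIdef : (HyperPoly.chartPre ε).DefinableSet I) :
    ∃ J : HyperPoly.Hyp (HyperPoly.chartPre ε), HyperPoly.Generates R n J.1 I := by
  have : Fact (HyperPoly.DefCharZero ε) := ⟨hK⟩
  exact HyperPoly.exists_generates hR hn hI hIdef
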